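/- **Notation.** Let $d\ge 1$ and $\widehat f(\xi)=\int_{\mathbb R^d} f(x)e^{-ix\cdot\xi}\,dx$ (extended to tempered distributions). For $r\in\mathbb R$, $H^r=H^r(\mathbb R^d)$ is the space of tempered distributions $u$ for which $\widehat u$ is a function with $\|u\|_{H^r}=(2\pi)^{-d/2}\big(\int|\widehat u(\xi)|^2(1+\|\xi\|_2^2)^r d\xi\big)^{1/2}<\infty$, and $\langle u,v\rangle=(2\pi)^{-d}\int\widehat u\,\overline{\widehat v}\,d\xi$ for $u\in H^r$, $v\in H^{-r}$. Let $M$ be a $d\times d$ integer matrix all of whose eigenvalues have modulus $>1$ and which is similar (over $\mathbb C$) to a diagonal matrix whose entries all have modulus $m:=|\det M|^{1/d}$. A distribution $u$ is $M$-refinable if $\widehat u(M^{T}\xi)=\widehat a(\xi)\widehat u(\xi)$ a.e. for a measurable $2\pi\mathbb Z^d$-periodic function $\widehat a$ (a mask symbol of $u$). For $\varphi\in H^{\varsigma}$, $\widetilde\varphi\in H^{-s}$, $N\in\mathbb N_0$ and a sequence $\varepsilon=\{\varepsilon_k\}_{k\in\mathbb Z^d}\subset\mathbb R^d$ put $$S^N_{\varphi;\varepsilon}f=\sum_{k\in\mathbb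 Z^d}\big\langle f,\,m^{N(d/2+s)}\widetilde\varphi(M^N\cdot-k-\varepsilon_k)\big\rangle\, m^{N(d/2-s)}\varphi(M^N\cdot-k),\qquad S^N_\varphi:=S^N_{\varphi;0},$$ the series being taken in $L^2(\mathbb R^d)$. For a sequence $x=\{x_k\}_{k\in\mathbb Z^d}\subset\mathbb R^d$ put $\|x\|_{\ell^p}=(\sum_k\|x_k\|_2^p)^{1/p}$ and, for given $\alpha>0$, $\|x\|_{\max}=\max\{\|x\|_{\ell^2},\|x\|_{\ell^\alpha}^{\alpha/2}\}$. **Theorem.** Let $d/2<s<\varsigma$ and $0<\alpha<\min\{2s-d,2\}$. Let $\varphi\in H^{\varsigma}$ and $\widetilde\varphi\in H^{-s}$ be $M$-refinable, with $\sum_{k\in\mathbb Z^d}|\widehat\varphi(\cdot+2\pi k)|^2\in L^\infty$ and $\widehat{\widetilde\varphi}\in L^\infty(\mathbb R^d)$. Then there is a constant $C_3>0$, depending only on $s,\varsigma,\alpha,d$ and on $M,\varphi,\widetilde\varphi$, such that for every $\lambda\in\mathbb R^d$, every sequence $\varepsilon$ with $\sum_{k}\|\varepsilon_k-\lambda\|_2^\alpha<\infty$,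 every $N\in\mathbb N_0$ with $N\ge\frac{2s+2-\alpha}{2-\alpha}\log_m d$ and every $f\in H^{\varsigma}$, the series defining $S^N_{\varphi}f$ and $S^N_{\varphi;\varepsilon}f$ converge unconditionally in $L^2$ and $$\|(I-S^N_{\varphi;\varepsilon})f\|_{L^2}\le\|(I-S^N_{\varphi})f\|_{L^2}+C_3\,\|f\|_{H^\varsigma}\,m^{-N\zeta}\big[\|\lambda\|_2^{\zeta}+\|\{\varepsilon_k-\lambda\}_{k}\|_{\max}\big],$$ $$\zeta=\min\Big\{1,\ \varsigma-s,\ \tfrac12\Big(\tfrac{4s+(\alpha-2)d}{2s-\alpha+2}+d\Big)\Big\}.$$ Moreover, for such $N$ and $f$, $S^N_\varphi f$ is the truncated framelet series $$S^N_\varphi f=\sum_{k}\langle f,\widetilde\varphi(\cdot-k)\rangle\varphi(\cdot-k)+\sum_{\ell=1}^{L}\sum_{j=0}^{N-1}\sum_{k}\big\langle f,m^{j(d/2+s)}\widetilde\psi^{\ell}(M^j\cdot-k)\big\rangle\,m^{j(d/2-s)}\psi^{\ell}(M^j\cdot-k),$$ with unconditional convergence in $L^2$ of each inner sum, whenever $\psi^\ell\in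 L^2(\mathbb R^d)$, $\widetilde\psi^\ell\in H^{-s}$ $(1\le\ell\le L)$ satisfy $\widehat{\psi^\ell}(M^T\cdot)=\widehat{b^\ell}\widehat\varphi$ and $\widehat{\widetilde\psi^\ell}(M^T\cdot)=\widehat{\widetilde b^\ell}\,\widehat{\widetilde\varphi}$ a.e. with $2\pi\mathbb Z^d$-periodic trigonometric polynomials $\widehat{b^\ell},\widehat{\widetilde b^\ell}$ such that, for mask symbols $\widehat a,\widehat{\widetilde a}$ of $\varphi,\widetilde\varphi$, all $\gamma\in (M^T)^{-1}\mathbb Z^d$ and a.e. $\xi$, $$\sum_{\ell=1}^{L}\overline{\widehat{b^\ell}(\xi+2\pi\gamma)}\,\widehat{\widetilde b^\ell}(\xi)+\overline{\widehat a(\xi+2\pi\gamma)}\,\widehat{\widetilde a}(\xi)=\begin{cases}1,&\gamma\in\mathbb Z^d,\\0,&\gamma\notin\mathbb Z^d.\end{cases}$$ -/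

import Mathlib

open MeasureTheory FourierTransform TemperedDistribution
open scoped SchwartzMap ENNReal

noncomputable section

namespace FrameletShift

/-- The Euclidean space `ℝᵈ`. -/
abbrev Euc (d : ℕ) : Type := EuclideanSpace ℝ (Fin d)

/-- Complex-valued `L²` functions on `ℝᵈ` (up to a.e. equality). -/
abbrev L2 (d : ℕ) : Type := Lp ℂ 2 (volume : Measure (Euc d))

variable {d : ℕ}

/-- The inclusion `ℤᵈ ⊆ ℝᵈ`. -/
def lat (k : Fin d → ℤ) : Euc d := WithLp.toLp 2 (fun i => (k i : ℝ))

/-! ### Fourier transforms, Sobolev norms and the duality pairing -/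

/-- The function `g` is the Fourier transform `û` of the tempered distribution `u`, in the
normalisation `û(ξ) = ∫ u(x) exp(-i x·ξ) dx`.  Mathlib's `𝓕` has the kernel `exp(-2πi x·η)`, so
that `𝓕 u` has to be the distribution given by the function `η ↦ g (2πη)`. -/
def IsFourierFun (u : 𝓢'(Euc d, ℂ)) (g : Euc d → ℂ) : Prop :=
  LocallyIntegrable g ∧
    ∀ θ : 𝓢(Euc d, ℂ), Integrable (fun η => θ η * g ((2 * Real.pi) • η)) ∧
      𝓕 u θ = ∫ η, θ η * g ((2 * Real.pi) • η)

open Classical in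
/-- The Fourier transform `û` of a tempered distribution whose Fourier transform is a (locally
integrable) function; it is determined up to a.e. equality.  All elements of the Sobolev spaces
have such a Fourier transform. -/
def hat (u : 𝓢'(Euc d, ℂ)) : Euc d → ℂ :=
  if h : ∃ g, IsFourierFun u g then h.choose else 0

/-- `‖u‖_{Hˢ} = (2π)^{-d/2} (∫ |û(ξ)|² (1 + |ξ|²)ˢ dξ)^{1/2}`, for `u ∈ Hˢ(ℝᵈ)`. -/
def sobolevNorm (s : ℝ) (u : 𝓢'(Euc d, ℂ)) : ℝ :=
  (2 * Real.pi) ^ (-(d : ℝ) / 2) *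
    Real.sqrt (∫ ξ, ‖hat u ξ‖ ^ 2 * (1 + ‖ξ‖ ^ 2) ^ s)

/-- The pairing `⟨u, v⟩ = (2π)^{-d} ∫ û(ξ) conj(v̂(ξ)) dξ` of `u ∈ Hˢ(ℝᵈ)` and `v ∈ H⁻ˢ(ℝᵈ)`. -/
def pairing (u v : 𝓢'(Euc d, ℂ)) : ℂ :=
  (((2 * Real.pi) ^ d)⁻¹ : ℝ) * ∫ ξ, hat u ξ * (starRingEnd ℂ) (hat v ξ)

/-! ### Dilation matrices -/

/-- `m = |det M|^{1/d}`. -/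
def scale (M : Matrix (Fin d) (Fin d) ℤ) : ℝ := |(M.det : ℝ)| ^ (1 / (d : ℝ))

/-- `M` is an isotropic dilation matrix: an integer matrix all of whose (complex) eigenvalues are
larger than `1` in modulus, and which is similar to a diagonal matrix whose entries all have
modulus `|det M|^{1/d}`. -/
structure IsIsotropicDilation (M : Matrix (Fin d) (Fin d) ℤ) : Prop where
  expanding : ∀ μ ∈ spectrum ℂ (M.map (Int.cast : ℤ → ℂ)), 1 < ‖μ‖
  isotropic : ∃ P D : Matrix (Fin d) (Fin d) ℂ, IsUnit P.det ∧ D.IsDiag ∧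
    M.map (Int.cast : ℤ → ℂ) = P * D * P⁻¹ ∧ ∀ i, ‖D i i‖ = scale M

/-- `M` with real entries. -/
def realMat (M : Matrix (Fin d) (Fin d) ℤ) : Matrix (Fin d) (Fin d) ℝ := M.map (Int.cast : ℤ → ℝ)

theorem IsIsotropicDilation.isUnit_det {M : Matrix (Fin d) (Fin d) ℤ}
    (hM : IsIsotropicDilation M) : IsUnit (realMat M).det := by
  have h0 : IsUnit (M.map (Int.cast : ℤ → ℂ)) := by
    by_contra h
    have : (0 : ℂ) ∈ spectrum ℂ (M.map (Int.cast : ℤ → ℂ)) := by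
      rwa [spectrum.zero_mem_iff]
    have := hM.expanding 0 this
    norm_num at this
  rw [Matrix.isUnit_iff_isUnit_det] at h0
  have h1 : (M.map (Int.cast : ℤ → ℂ)).det = (M.det : ℂ) := ((Int.castRingHom ℂ).map_det M).symm
  have h2 : (realMat M).det = (M.det : ℝ) := ((Int.castRingHom ℝ).map_det M).symm
  rw [h1, isUnit_iff_ne_zero] at h0
  rw [h2, isUnit_iff_ne_zero]
  exact_mod_cast h0

/-- The matrix-vector product on `ℝᵈ`. -/
def act (B : Matrix (Fin d) (Fin d) ℝ) (x : Euc d) : Euc d := WithLp.toLp 2 (B.mulVec x.ofLp)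

/-- `x ↦ M x` as a linear automorphism of `ℝᵈ`. -/
def IsIsotropicDilation.equiv {M : Matrix (Fin d) (Fin d) ℤ} (hM : IsIsotropicDilation M) :
    Euc d ≃L[ℝ] Euc d :=
  LinearEquiv.toContinuousLinearEquiv
    { toFun := act (realMat M)
      invFun := act (realMat M)⁻¹
      map_add' := fun x y => by simp [act, Matrix.mulVec_add]
      map_smul' := fun c x => by simp [act, Matrix.mulVec_smul]
      left_inv := fun x => by
        simp [act, Matrix.mulVec_mulVec, Matrix.nonsing_inv_mul _ hM.isUnit_det]
      right_inv := fun x => by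
        simp [act, Matrix.mulVec_mulVec, Matrix.mul_nonsing_inv _ hM.isUnit_det] }

/-! ### Dilated and shifted functions and distributions -/

/-- The distribution `u(A · - y)`, i.e. `θ ↦ |det A|⁻¹ u(θ(A⁻¹(· + y)))`. -/
def distComp (A : Euc d ≃L[ℝ] Euc d) (y : Euc d) (u : 𝓢'(Euc d, ℂ)) : 𝓢'(Euc d, ℂ) :=
  ((|LinearMap.det (A.toLinearEquiv : Euc d →ₗ[ℝ] Euc d)|⁻¹ : ℝ) : ℂ) •
    PointwiseConvergenceCLM.precomp ℂ
      ((SchwartzMap.compSubConstCLM ℂ (-y)).comp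
        (SchwartzMap.compCLMOfContinuousLinearEquiv ℂ A.symm)) u

theorem memLp_comp_affine (A : Euc d ≃L[ℝ] Euc d) (y : Euc d) (f : L2 d) :
    MemLp (fun x => f (A x - y)) 2 (volume : Measure (Euc d)) := by
  have h1 : MemLp (fun x => f (x - y)) 2 (volume : Measure (Euc d)) :=
    (Lp.memLp f).comp_measurePreserving (measurePreserving_sub_right volume y)
  have hdet : LinearMap.det (A.toLinearEquiv : Euc d →ₗ[ℝ] Euc d) ≠ 0 :=
    (LinearEquiv.isUnit_det' A.toLinearEquiv).ne_zero
  have hmap : Measure.map A (volume : Measure (Euc d)) =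
      ENNReal.ofReal |(LinearMap.det (A.toLinearEquiv : Euc d →ₗ[ℝ] Euc d))⁻¹| • volume :=
    Measure.map_linearMap_addHaar_eq_smul_addHaar volume hdet
  have h2 : MemLp (fun x => f (x - y)) 2 (Measure.map A (volume : Measure (Euc d))) := by
    rw [hmap]
    exact h1.smul_measure ENNReal.ofReal_ne_top
  exact h2.comp_of_map A.continuous.measurable.aemeasurable

/-- The function `f(A · - y)`. -/
def funComp (A : Euc d ≃L[ℝ] Euc d) (y : Euc d) (f : L2 d) : L2 d :=
  (memLp_comp_affine A y f).toLp _

section Operators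

variable {M : Matrix (Fin d) (Fin d) ℤ} (hM : IsIsotropicDilation M) (s : ℝ)

/-- `φˢ_{N,k} = m^{N(d/2-s)} φ(Mᴺ · - k)`. -/
def primalAtom (φ : L2 d) (N : ℕ) (k : Fin d → ℤ) : L2 d :=
  ((scale M ^ ((N : ℝ) * ((d : ℝ) / 2 - s)) : ℝ) : ℂ) • funComp (hM.equiv ^ N) (lat k) φ

/-- `m^{N(d/2+s)} φ̃(Mᴺ · - y)`; this is `φ̃⁻ˢ_{N,k}` for `y = k`, and its shift-perturbed version
for `y = k + ε_k`. -/
def dualAtom (φt : 𝓢'(Euc d, ℂ)) (N : ℕ) (y : Euc d) : 𝓢'(Euc d, ℂ) :=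
  ((scale M ^ ((N : ℝ) * ((d : ℝ) / 2 + s)) : ℝ) : ℂ) • distComp (hM.equiv ^ N) y φt

/-- The summands `⟨f, m^{N(d/2+s)} φ̃(Mᴺ · - k - ε_k)⟩ φˢ_{N,k}`. -/
def shiftTerm (φ : L2 d) (φt : 𝓢'(Euc d, ℂ)) (N : ℕ) (ε : (Fin d → ℤ) → Euc d) (f : L2 d)
    (k : Fin d → ℤ) : L2 d :=
  pairing (f : 𝓢'(Euc d, ℂ)) (dualAtom hM s φt N (lat k + ε k)) • primalAtom hM s φ N k

/-- The shift-perturbed operator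
`S^N_{φ;ε} f = ∑_k ⟨f, m^{N(d/2+s)} φ̃(Mᴺ · - k - ε_k)⟩ φˢ_{N,k}`, the series being taken in
`L²(ℝᵈ)`.  For `ε = 0` it is `S^N_φ f = ∑_k ⟨f, φ̃⁻ˢ_{N,k}⟩ φˢ_{N,k}`. -/
def shiftOp (φ : L2 d) (φt : 𝓢'(Euc d, ℂ)) (N : ℕ) (ε : (Fin d → ℤ) → Euc d) (f : L2 d) : L2 d :=
  ∑' k, shiftTerm hM s φ φt N ε f k

/-- The truncated framelet series
`∑_k ⟨f, φ̃_{0,k}⟩ φ_{0,k} + ∑_ℓ ∑_{j<N} ∑_k ⟨f, ψ̃^{ℓ,-s}_{j,k}⟩ ψ^{ℓ,s}_{j,k}`. -/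
def frameletOp {L : ℕ} (φ : L2 d) (φt : 𝓢'(Euc d, ℂ)) (ψ : Fin L → L2 d)
    (ψt : Fin L → 𝓢'(Euc d, ℂ)) (N : ℕ) (f : L2 d) : L2 d :=
  shiftOp hM s φ φt 0 0 f + ∑ l, ∑ j ∈ Finset.range N, shiftOp hM s (ψ l) (ψt l) j 0 f

end Operators

/-! ### Refinable functions and the mixed extension principle -/

/-- `a` is a mask symbol of `u`: a `2πℤᵈ`-periodic (measurable) function with
`û(Mᵀξ) = a(ξ) û(ξ)`. -/
structure IsMask (M : Matrix (Fin d) (Fin d) ℤ) (u : 𝓢'(Euc d, ℂ)) (a : Euc d → ℂ) : Prop where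
  measurable : AEStronglyMeasurable a volume
  periodic : ∀ (k : Fin d → ℤ) (ξ : Euc d), a (ξ + (2 * Real.pi) • lat k) = a ξ
  refine_eq : ∀ᵐ ξ, hat u (act (realMat M).transpose ξ) = a ξ * hat u ξ

/-- `u` is `M`-refinable. -/
def IsRefinable (M : Matrix (Fin d) (Fin d) ℤ) (u : 𝓢'(Euc d, ℂ)) : Prop := ∃ a, IsMask M u a

/-- The trigonometric polynomial `∑_k c_k exp(i k·ξ)` (a finite sum). -/
def trigPoly (c : (Fin d → ℤ) →₀ ℂ) (ξ : Euc d) : ℂ :=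
  c.sum fun k z => z * Complex.exp (Complex.I * ((inner ℝ (lat k) ξ : ℝ) : ℂ))

/-- `ψ¹, …, ψᴸ` and `ψ̃¹, …, ψ̃ᴸ` are wavelet functions obtained from the `M`-refinable `φ` and `φ̃`
by the mixed extension principle, with mask symbols `b¹, …, bᴸ` and `b̃¹, …, b̃ᴸ`: for all
`γ = (Mᵀ)⁻¹k`, `k ∈ ℤᵈ`,
`∑_ℓ conj(bˡ(ξ + 2πγ)) b̃ˡ(ξ) + conj(a(ξ + 2πγ)) ã(ξ)` is `1` if `γ ∈ ℤᵈ` and `0` otherwise. -/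
structure IsMEPSystem (M : Matrix (Fin d) (Fin d) ℤ) (s : ℝ) (φ : L2 d) (φt : 𝓢'(Euc d, ℂ))
    {L : ℕ} (ψ : Fin L → L2 d) (ψt : Fin L → 𝓢'(Euc d, ℂ)) (a at' : Euc d → ℂ)
    (b bt : Fin L → ((Fin d → ℤ) →₀ ℂ)) : Prop where
  mask : IsMask M (φ : 𝓢'(Euc d, ℂ)) a
  dual_mask : IsMask M φt at'
  wavelet : ∀ l, ∀ᵐ ξ, hat (ψ l : 𝓢'(Euc d, ℂ)) (act (realMat M).transpose ξ) =
    trigPoly (b l) ξ * hat (φ : 𝓢'(Euc d, ℂ)) ξ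
  dual_mem : ∀ l, MemSobolev (-s) 2 (ψt l)
  dual_wavelet : ∀ l, ∀ᵐ ξ, hat (ψt l) (act (realMat M).transpose ξ) =
    trigPoly (bt l) ξ * hat φt ξ
  mep : ∀ᵐ ξ, ∀ k : Fin d → ℤ,
    (∑ l, (starRingEnd ℂ) (trigPoly (b l)
        (ξ + (2 * Real.pi) • act (realMat M).transpose⁻¹ (lat k))) * trigPoly (bt l) ξ) +
      (starRingEnd ℂ) (a (ξ + (2 * Real.pi) • act (realMat M).transpose⁻¹ (lat k))) * at' ξ =
    Set.indicator (Set.range fun n : Fin d → ℤ => M.transpose.mulVec n) (fun _ => (1 : ℂ)) k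

/-- `[φ̂, φ̂]₀(ξ) = ∑_{k ∈ ℤᵈ} |φ̂(ξ + 2πk)|²`, with values in `[0, ∞]`. -/
def bracket (φ : L2 d) (ξ : Euc d) : ℝ≥0∞ :=
  ∑' k : Fin d → ℤ, ‖hat (φ : 𝓢'(Euc d, ℂ)) (ξ + (2 * Real.pi) • lat k)‖ₑ ^ 2

/-! ### The quantities in the estimate -/

/-- `‖x‖_{ℓᵖ(ℤᵈ)} = (∑_k ‖x_k‖₂ᵖ)^{1/p}`. -/
def ellNorm (p : ℝ) (x : (Fin d → ℤ) → Euc d) : ℝ := (∑' k, ‖x k‖ ^ p) ^ (1 / p)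

/-- `‖x‖_max = max {‖x‖_{ℓ²}, ‖x‖_{ℓ^α}^{α/2}}`. -/
def maxNorm (α : ℝ) (x : (Fin d → ℤ) → Euc d) : ℝ := max (ellNorm 2 x) (ellNorm α x ^ (α / 2))

/-- `ζ = min {1, ς - s, ((4s + (α-2)d)/(2s-α+2) + d)/2}`. -/
def zetaExp (d : ℕ) (s ς α : ℝ) : ℝ :=
  min 1 (min (ς - s) (((4 * s + (α - 2) * d) / (2 * s - α + 2) + d) / 2))

end FrameletShift

end

/-! Everything is computed on the Fourier side, with `ft u η = û(2πη)`. By `pairing_dualAtom`, the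
coefficient of `f` against the dual atom placed at `y` is `m^{N(d/2+s)}` times the inverse Fourier
transform at `y` of one function, `G(η) = f̂((Mᵀ)ᴺη) · conj(ṽ(η))`, where `ṽ` is the transform of
the dual generator. Moving the atom thus means sampling the same function elsewhere.

At lattice points the samples are the Fourier coefficients of the ℤᵈ-periodization of `G`. Since `s
> d/2`, a weighted Cauchy–Schwarz inequality (`exists_periodize_bound`) places that periodization in
`L²` of the unit cube. The bounded bracket makes the synthesis map from `L²` of the cube into
`L²(ℝᵈ)` bounded, with norm at most `m^{-Ns}√B` (`exists_atomSynthesis`). Its image of an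
orthonormal expansion converges unconditionally.

For the perturbed operator write `ε_k = λ + x_k`. The common shift `λ` multiplies `G` by `e^{2πiλ·η}
- 1 = O(|λ|^ζ |η|^ζ)`, and isotropy gives `|η| ≤ K m^{-N} |(Mᵀ)ᴺη|`
(`IsIsotropicDilation.exists_norm_symm_le`). The factor `|η|^ζ` therefore costs `ζ` derivatives of
`f`, available because `s + ζ ≤ ς`, and gains `m^{-Nζ}`. The individual shifts `x_k` are not a
modulation of `G`. For them the samples are Hölder continuous of some order `β`
(`exists_sampleValue_sub_le`), so the coefficient errors lie in `ℓ²` with square norm `O(∑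
|x_k|^{2β})`. For `α ≤ 2β ≤ 2` this is controlled by the max norm. Both contributions meet in
`exists_shift_estimate`. Of `ζ` it uses only `0 < ζ ≤ min{1, ς - s}`.

The framelet formula is a telescoping sum. Expanding the level-`j` periodizations at `Mᵀη` over the
points `η + (Mᵀ)⁻¹n`, the mixed extension principle cancels every `n` outside `Mᵀℤᵈ`, and what
remains is the periodization at level `j+1` (`cascade_ae`, `IsMEPSystem.shiftOp_succ`). -/

noncomputable section

namespace FrameletShift

variable {d : ℕ}

/-! ### Linear changes of variables -/

/-- The absolute value of the determinant of a linear automorphism. -/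
def absDet (A : Euc d ≃L[ℝ] Euc d) : ℝ := |LinearMap.det (A.toLinearEquiv : Euc d →ₗ[ℝ] Euc d)|

theorem absDet_pos (A : Euc d ≃L[ℝ] Euc d) : 0 < absDet A :=
  abs_pos.2 (LinearEquiv.isUnit_det' A.toLinearEquiv).ne_zero

theorem absDet_symm (A : Euc d ≃L[ℝ] Euc d) : absDet A.symm = (absDet A)⁻¹ := by
  have h : absDet A.symm * absDet A = 1 := by
    unfold absDet
    rw [← abs_mul, ← LinearMap.det_comp]
    have : (A.symm.toLinearEquiv : Euc d →ₗ[ℝ] Euc d) ∘ₗ (A.toLinearEquiv : Euc d →ₗ[ℝ] Euc d) =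
        LinearMap.id := by
      ext x; simp
    rw [this]; simp
  exact eq_inv_of_mul_eq_one_left h

theorem map_volume_equiv (A : Euc d ≃L[ℝ] Euc d) :
    Measure.map A (volume : Measure (Euc d)) = ENNReal.ofReal (absDet A)⁻¹ • volume := by
  have h : Measure.map A (volume : Measure (Euc d)) =
      ENNReal.ofReal |(LinearMap.det (A.toLinearEquiv : Euc d →ₗ[ℝ] Euc d))⁻¹| • volume :=
    Measure.map_linearMap_addHaar_eq_smul_addHaar volume
      (LinearEquiv.isUnit_det' A.toLinearEquiv).ne_zero
  rw [h, abs_inv, absDet]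

theorem measurableEmbedding_equiv (A : Euc d ≃L[ℝ] Euc d) : MeasurableEmbedding A :=
  A.toHomeomorph.measurableEmbedding

theorem quasiMeasurePreserving_equiv (A : Euc d ≃L[ℝ] Euc d) :
    Measure.QuasiMeasurePreserving A (volume : Measure (Euc d)) volume :=
  ⟨A.continuous.measurable, by
    rw [map_volume_equiv]; exact Measure.smul_absolutelyContinuous⟩

theorem integral_comp_equiv {E : Type*} [NormedAddCommGroup E] [NormedSpace ℝ E]
    (A : Euc d ≃L[ℝ] Euc d) (F : Euc d → E) :
    ∫ x, F (A x) = (absDet A)⁻¹ • ∫ x, F x := by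
  rw [← (measurableEmbedding_equiv A).integral_map, map_volume_equiv, integral_smul_measure,
    ENNReal.toReal_ofReal (inv_nonneg.2 (absDet_pos A).le)]

theorem lintegral_comp_equiv (A : Euc d ≃L[ℝ] Euc d) (F : Euc d → ℝ≥0∞) :
    ∫⁻ x, F (A x) = ENNReal.ofReal (absDet A)⁻¹ * ∫⁻ x, F x := by
  rw [← (measurableEmbedding_equiv A).lintegral_map, map_volume_equiv, lintegral_smul_measure,
    smul_eq_mul]

theorem integrable_comp_equiv {E : Type*} [NormedAddCommGroup E]
    (A : Euc d ≃L[ℝ] Euc d) (F : Euc d → E) :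
    Integrable (fun x => F (A x)) ↔ Integrable F := by
  have := (measurableEmbedding_equiv A).integrable_map_iff (μ := volume) (g := F)
  rw [map_volume_equiv, integrable_smul_measure
    (by simpa using absDet_pos A) ENNReal.ofReal_ne_top] at this
  exact this.symm

theorem locallyIntegrable_comp_equiv {E : Type*} [NormedAddCommGroup E]
    (A : Euc d ≃L[ℝ] Euc d) {F : Euc d → E} (hF : LocallyIntegrable F) :
    LocallyIntegrable (fun x => F (A x)) := by
  have h := (locallyIntegrable_map_homeomorph A.toHomeomorph (f := F) (μ := volume)).1
  refine h ?_
  have : Measure.map A.toHomeomorph (volume : Measure (Euc d)) =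
      ENNReal.ofReal (absDet A)⁻¹ • volume := map_volume_equiv A
  rw [this]
  intro x
  obtain ⟨U, hU, hi⟩ := hF x
  refine ⟨U, hU, ?_⟩
  rw [IntegrableOn, Measure.restrict_smul]
  exact hi.smul_measure ENNReal.ofReal_ne_top

/-- Multiplication by a nonzero scalar. -/
def smulEquiv (c : ℝ) (hc : c ≠ 0) : Euc d ≃L[ℝ] Euc d :=
  ContinuousLinearEquiv.smulLeft (Units.mk0 c hc)

@[simp] theorem smulEquiv_apply (c : ℝ) (hc : c ≠ 0) (x : Euc d) : smulEquiv c hc x = c • x := rfl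

theorem absDet_smulEquiv (c : ℝ) (hc : c ≠ 0) : absDet (smulEquiv c hc : Euc d ≃L[ℝ] Euc d) =
    |c| ^ d := by
  unfold absDet
  have : ((smulEquiv c hc : Euc d ≃L[ℝ] Euc d).toLinearEquiv : Euc d →ₗ[ℝ] Euc d) =
      c • LinearMap.id := by
    ext x; simp
  rw [this, LinearMap.det_smul]
  simp [abs_pow]

/-! ### The Fourier transform as a function -/

/-- The Fourier transform with kernel `exp(-2πi x·η)`: `ft u η = û(2πη)`. -/
def ft (u : 𝓢'(Euc d, ℂ)) (η : Euc d) : ℂ := hat u ((2 * Real.pi) • η)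

/-- `g` is the Fourier transform of `u` in the normalisation with kernel `exp(-2πi x·η)`. -/
def IsFt (u : 𝓢'(Euc d, ℂ)) (g : Euc d → ℂ) : Prop :=
  LocallyIntegrable g ∧ ∀ θ : 𝓢(Euc d, ℂ), Integrable (fun η => θ η * g η) ∧
    𝓕 u θ = ∫ η, θ η * g η

theorem two_pi_ne_zero : (2 * Real.pi : ℝ) ≠ 0 := by positivity

theorem IsFourierFun.isFt {u : 𝓢'(Euc d, ℂ)} {g : Euc d → ℂ} (h : IsFourierFun u g) :
    IsFt u (fun η => g ((2 * Real.pi) • η)) :=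
  ⟨locallyIntegrable_comp_equiv (smulEquiv _ two_pi_ne_zero) h.1, h.2⟩

theorem IsFt.isFourierFun {u : 𝓢'(Euc d, ℂ)} {g : Euc d → ℂ} (h : IsFt u g) :
    IsFourierFun u (fun ξ => g ((2 * Real.pi)⁻¹ • ξ)) := by
  refine ⟨locallyIntegrable_comp_equiv (smulEquiv _ (inv_ne_zero two_pi_ne_zero)) h.1, ?_⟩
  simpa only [smul_smul, inv_mul_cancel₀ two_pi_ne_zero, one_smul] using h.2

/-- Integrals against compactly supported smooth functions determine a locally integrable function
a.e. Results about `ft` therefore do not depend on the choice made in `hat`. -/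
theorem IsFt.ae_eq {u : 𝓢'(Euc d, ℂ)} {g h : Euc d → ℂ} (hg : IsFt u g) (hh : IsFt u h) :
    g =ᵐ[volume] h := by
  have : ∀ᵐ x, (g - h) x = 0 := by
    refine ae_eq_zero_of_integral_contDiff_smul_eq_zero (hg.1.sub hh.1) fun θ hθ hc => ?_
    have hg₁ : HasCompactSupport (Complex.ofRealCLM ∘ θ) := hc.comp_left rfl
    have hg₂ : ContDiff ℝ (↑(⊤ : ℕ∞)) (Complex.ofRealCLM ∘ θ) := by fun_prop
    have h1 := hg.2 (hg₁.toSchwartzMap hg₂)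
    have h2 := hh.2 (hg₁.toSchwartzMap hg₂)
    have h3 := h1.2.symm.trans h2.2
    rw [← sub_eq_zero, ← integral_sub h1.1 h2.1] at h3
    rw [← h3]
    refine integral_congr_ae (Filter.Eventually.of_forall fun x => ?_)
    simp [mul_sub]
  filter_upwards [this] with x hx
  exact sub_eq_zero.1 hx

theorem IsFt.isFt_ft {u : 𝓢'(Euc d, ℂ)} {g : Euc d → ℂ} (h : IsFt u g) : IsFt u (ft u) := by
  have hex : ∃ g, IsFourierFun u g := ⟨_, h.isFourierFun⟩
  have : IsFourierFun u (hat u) := by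
    unfold hat
    rw [dif_pos hex]
    exact hex.choose_spec
  exact this.isFt

theorem IsFt.ft_ae_eq {u : 𝓢'(Euc d, ℂ)} {g : Euc d → ℂ} (h : IsFt u g) : ft u =ᵐ[volume] g :=
  h.isFt_ft.ae_eq h

theorem isFt_L2 (f : L2 d) : IsFt (f : 𝓢'(Euc d, ℂ)) (𝓕 f : L2 d) := by
  refine ⟨(Lp.memLp (𝓕 f : L2 d)).locallyIntegrable (by norm_num), fun θ => ⟨?_, ?_⟩⟩
  · exact (Lp.memLp (𝓕 f : L2 d)).integrable_mul (θ.memLp 2 volume) |>.congr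
      (Filter.Eventually.of_forall fun x => by simp [mul_comm])
  · rw [Lp.fourier_toTemperedDistribution_eq, Lp.toTemperedDistribution_apply]
    simp

theorem ft_L2 (f : L2 d) : ft (f : 𝓢'(Euc d, ℂ)) =ᵐ[volume] (𝓕 f : L2 d) := (isFt_L2 f).ft_ae_eq

/-- A tempered distribution in a Sobolev space has a Fourier transform that is a function, square
integrable with respect to the corresponding weight. -/
theorem exists_isFt_of_memSobolev {r : ℝ} {u : 𝓢'(Euc d, ℂ)} (hu : MemSobolev r 2 u) :
    IsFt u (ft u) ∧ MemLp (fun η => ((1 + ‖η‖ ^ 2) ^ (r / 2) : ℝ) * ft u η) 2 volume := by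
  obtain ⟨g, hg⟩ := memSobolev_iff_exists_smulLeftCLM_fourier.1 hu
  have hpos : ∀ x : Euc d, (0 : ℝ) < 1 + ‖x‖ ^ 2 := fun x => by positivity
  have hcont : ∀ t : ℝ, Continuous fun x : Euc d => ((1 + ‖x‖ ^ 2) ^ t : ℝ) := fun t =>
    Continuous.rpow_const (by fun_prop) fun x => Or.inl (hpos x).ne'
  -- Membership provides an `L²` function `g` equal to the weighted transform. Dividing by the
  -- weight gives the transform itself, and in the pairing the weight is moved onto the test
  -- function.
  have hft : IsFt u (fun η => ((1 + ‖η‖ ^ 2) ^ (-r / 2) : ℝ) * g η) := by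
    refine ⟨?_, fun θ => ?_⟩
    · exact ((Lp.memLp g).locallyIntegrable (by norm_num)).continuous_mul
        (Complex.continuous_ofReal.comp (hcont (-r / 2)))
    · set θ' : 𝓢(Euc d, ℂ) := SchwartzMap.smulLeftCLM ℂ
        (fun x : Euc d => (((1 + ‖x‖ ^ 2) ^ (-r / 2) : ℝ) : ℂ)) θ with hθ'
      have hval : ∀ x, θ' x = (((1 + ‖x‖ ^ 2) ^ (-r / 2) : ℝ) : ℂ) * θ x := fun x => by
        rw [hθ', SchwartzMap.smulLeftCLM_apply_apply (by fun_prop), smul_eq_mul]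
      have heq : ∀ x, θ x * ((((1 + ‖x‖ ^ 2) ^ (-r / 2) : ℝ) : ℂ) * g x) = θ' x * g x := fun x => by
        rw [hval]; ring
      simp_rw [heq]
      refine ⟨?_, ?_⟩
      · exact (Lp.memLp g).integrable_mul (θ'.memLp 2 volume) |>.congr
          (Filter.Eventually.of_forall fun x => by simp [mul_comm])
      · have h1 := congrArg (fun v : 𝓢'(Euc d, ℂ) => v θ') hg
        simp only [smulLeftCLM_apply_apply, Lp.toTemperedDistribution_apply, smul_eq_mul] at h1
        rw [← h1]
        congr 1
        ext x
        rw [SchwartzMap.smulLeftCLM_apply_apply (by fun_prop), hval, smul_eq_mul, ← mul_assoc,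
          ← Complex.ofReal_mul, ← Real.rpow_add (hpos x)]
        simp [neg_div]
  refine ⟨hft.isFt_ft, (memLp_congr_ae ?_).2 (Lp.memLp g)⟩
  filter_upwards [hft.ft_ae_eq] with x hx
  rw [hx, ← mul_assoc, ← Complex.ofReal_mul, ← Real.rpow_add (hpos x)]
  simp [neg_div]

/-! ### The Fourier transform of dilated and shifted distributions -/

/-- The character `η ↦ exp(2πi y·η)`. -/
def chr (y η : Euc d) : ℂ := Complex.exp ((2 * Real.pi * inner ℝ y η : ℝ) * Complex.I)

theorem norm_chr (y η : Euc d) : ‖chr y η‖ = 1 := Complex.norm_exp_ofReal_mul_I _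

theorem chr_add (y z η : Euc d) : chr (y + z) η = chr y η * chr z η := by
  simp only [chr, ← Complex.exp_add, inner_add_left]; congr 1; push_cast; ring

theorem chr_add_right (y η ζ : Euc d) : chr y (η + ζ) = chr y η * chr y ζ := by
  simp only [chr, ← Complex.exp_add, inner_add_right]; congr 1; push_cast; ring

theorem chr_neg (y η : Euc d) : chr (-y) η = (starRingEnd ℂ) (chr y η) := by
  simp only [chr, ← Complex.exp_conj, inner_neg_left]
  simp [Complex.conj_ofNat]

theorem continuous_chr (y : Euc d) : Continuous (chr y) := by unfold chr; fun_prop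

/-- `B` is the inverse transpose of `A`. -/
def IsContragredient (A B : Euc d ≃L[ℝ] Euc d) : Prop :=
  ∀ x η, inner ℝ (A x) (B η) = inner ℝ x η

theorem det_adjoint (f : Euc d →ₗ[ℝ] Euc d) : LinearMap.det (LinearMap.adjoint f) =
    LinearMap.det f := by
  let b := EuclideanSpace.basisFun (Fin d) ℝ
  rw [← LinearMap.det_toMatrix b.toBasis, ← LinearMap.det_toMatrix b.toBasis,
    LinearMap.toMatrix_adjoint, Matrix.det_conjTranspose]
  simp

/-- The contragredient of `A` is the adjoint of `A⁻¹`, and adjoints have the same determinant. -/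
theorem IsContragredient.absDet {A B : Euc d ≃L[ℝ] Euc d} (h : IsContragredient A B) :
    absDet B = (absDet A)⁻¹ := by
  rw [← absDet_symm]
  have : (B.toLinearEquiv : Euc d →ₗ[ℝ] Euc d) =
      LinearMap.adjoint (A.symm.toLinearEquiv : Euc d →ₗ[ℝ] Euc d) := by
    rw [LinearMap.eq_adjoint_iff]
    intro x y
    have := h (A.symm y) x
    rw [A.apply_symm_apply] at this
    rw [real_inner_comm]
    exact this.trans (real_inner_comm _ _)
  unfold FrameletShift.absDet
  rw [this, det_adjoint]

theorem IsFt.smul {u : 𝓢'(Euc d, ℂ)} {g : Euc d → ℂ} (h : IsFt u g) (c : ℂ) :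
    IsFt (c • u) (fun η => c * g η) := by
  refine ⟨h.1.smul c, fun θ => ⟨?_, ?_⟩⟩
  · exact ((h.2 θ).1.const_mul c).congr (Filter.Eventually.of_forall fun x => by simp; ring)
  · have : 𝓕 (c • u) θ = c * 𝓕 u θ := rfl
    rw [this, (h.2 θ).2, ← integral_const_mul]
    congr 1; ext x; ring

/-- The Schwartz function whose Fourier transform is `(𝓕 θ)(A⁻¹(· + y))`. -/
theorem fourierInv_comp_affine {A B : Euc d ≃L[ℝ] Euc d} (h : IsContragredient A B) (y : Euc d)
    (θ : 𝓢(Euc d, ℂ)) (ζ : Euc d) :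
    𝓕⁻ (SchwartzMap.compSubConstCLM ℂ (-y)
      (SchwartzMap.compCLMOfContinuousLinearEquiv ℂ A.symm (𝓕 θ))) (B ζ) =
      absDet A * chr (-y) (B ζ) * θ ζ := by
  rw [SchwartzMap.fourierInv_coe, Real.fourierInv_eq']
  simp only [SchwartzMap.compSubConstCLM_apply, SchwartzMap.compCLMOfContinuousLinearEquiv_apply,
    Function.comp_apply]
  have hθ : θ ζ = ∫ v, Complex.exp ((2 * Real.pi * inner ℝ v ζ : ℝ) * Complex.I) • (𝓕 θ) v := by
    rw [← Real.fourierInv_eq', ← SchwartzMap.fourierInv_coe, fourierInv_fourier_eq]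
  have h1 := integral_comp_equiv A.symm (fun x =>
    Complex.exp ((2 * Real.pi * inner ℝ x ζ : ℝ) * Complex.I) • (𝓕 θ) x)
  rw [← hθ, absDet_symm, inv_inv] at h1
  rw [← integral_sub_right_eq_self _ y]
  have h2 : ∀ x, Complex.exp ((2 * Real.pi * inner ℝ (x - y) (B ζ) : ℝ) * Complex.I) •
      (𝓕 θ) (A.symm (x - y - -y)) = chr (-y) (B ζ) *
      (Complex.exp ((2 * Real.pi * inner ℝ (A.symm x) ζ : ℝ) * Complex.I) •
        (𝓕 θ) (A.symm x)) := fun x => by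
    rw [sub_neg_eq_add, sub_add_cancel, ← h (A.symm x) ζ, A.apply_symm_apply, chr]
    simp only [smul_eq_mul, ← mul_assoc, ← Complex.exp_add]
    congr 2
    rw [inner_sub_left, inner_neg_left]
    push_cast
    ring
  simp_rw [h2]
  rw [integral_const_mul, h1]
  simp only [Complex.real_smul]
  ring

/-- By duality the affine substitution passes to the test function, where `fourierInv_comp_affine`
turns it into a character and the contragredient substitution. -/
theorem IsFt.distComp {u : 𝓢'(Euc d, ℂ)} {g : Euc d → ℂ} (hu : IsFt u g)
    {A B : Euc d ≃L[ℝ] Euc d} (h : IsContragredient A B) (y : Euc d) :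
    IsFt (distComp A y u) (fun η => ((absDet A)⁻¹ : ℝ) * (chr (-y) (B η) * g (B η))) := by
  refine ⟨?_, fun θ => ?_⟩
  · refine (LocallyIntegrable.continuous_mul ((continuous_chr (-y)).comp B.continuous)
      (locallyIntegrable_comp_equiv B hu.1)).smul (((absDet A)⁻¹ : ℝ) : ℂ)
  set θ' : 𝓢(Euc d, ℂ) := 𝓕⁻ (SchwartzMap.compSubConstCLM ℂ (-y)
      (SchwartzMap.compCLMOfContinuousLinearEquiv ℂ A.symm (𝓕 θ))) with hθ'
  have hval : ∀ ζ, θ' (B ζ) = absDet A * chr (-y) (B ζ) * θ ζ := fourierInv_comp_affine h y θ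
  have hA : (absDet A : ℂ) ≠ 0 := by exact_mod_cast (absDet_pos A).ne'
  -- One inverse determinant is the prefactor here and the other comes from solving `hval` for `θ`.
  -- The substitution by `B` later cancels one of them.
  have heq : ∀ η, θ η * (((absDet A)⁻¹ : ℝ) * (chr (-y) (B η) * g (B η))) =
      (((absDet A)⁻¹ : ℝ) : ℂ) ^ 2 * (θ' (B η) * g (B η)) := fun η => by
    rw [hval]; push_cast; field_simp
  simp_rw [heq]
  refine ⟨((integrable_comp_equiv B (fun η => θ' η * g η)).2 (hu.2 θ').1).const_mul _, ?_⟩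
  rw [integral_const_mul, integral_comp_equiv B (fun η => θ' η * g η), ← (hu.2 θ').2, h.absDet,
    inv_inv]
  have h1 : 𝓕 (FrameletShift.distComp A y u) θ = (((absDet A)⁻¹ : ℝ) : ℂ) * 𝓕 u θ' := by
    rw [TemperedDistribution.fourier_apply, TemperedDistribution.fourier_apply, hθ',
      fourier_fourierInv_eq]
    rfl
  rw [h1, Complex.real_smul]
  push_cast
  field_simp

theorem funComp_toTemperedDistribution (A : Euc d ≃L[ℝ] Euc d) (y : Euc d) (f : L2 d) :
    (funComp A y f : 𝓢'(Euc d, ℂ)) = distComp A y (f : 𝓢'(Euc d, ℂ)) := by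
  ext θ
  rw [Lp.toTemperedDistribution_apply]
  have h1 : distComp A y (f : 𝓢'(Euc d, ℂ)) θ = (((absDet A)⁻¹ : ℝ) : ℂ) *
      ∫ x, θ (A.symm (x + y)) * f x := by
    change (((absDet A)⁻¹ : ℝ) : ℂ) * (f : 𝓢'(Euc d, ℂ)) _ = _
    rw [Lp.toTemperedDistribution_apply]
    simp
  rw [h1]
  have h2 := integral_comp_equiv A (fun x => θ (A.symm x) * f (x - y))
  have h3 : ∫ x, θ (A.symm (x + y)) * f x = ∫ x, θ (A.symm x) * f (x - y) := by
    rw [← integral_sub_right_eq_self _ y]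
    simp
  rw [h3, ← Complex.real_smul, ← h2]
  refine integral_congr_ae ?_
  filter_upwards [(memLp_comp_affine A y f).coeFn_toLp] with x hx
  rw [smul_eq_mul, A.symm_apply_apply]
  congr 1

/-- The factor `(2π)^{-d}` is the Jacobian of `ξ = 2πη`. -/
theorem pairing_eq (u v : 𝓢'(Euc d, ℂ)) :
    pairing u v = ∫ η, ft u η * (starRingEnd ℂ) (ft v η) := by
  have h := integral_comp_equiv (smulEquiv (2 * Real.pi) two_pi_ne_zero)
    (fun ξ : Euc d => hat u ξ * (starRingEnd ℂ) (hat v ξ))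
  rw [absDet_smulEquiv, abs_of_pos (by positivity)] at h
  rw [pairing, ← Complex.real_smul, ← h]
  rfl

theorem sobolevNorm_sq (r : ℝ) (u : 𝓢'(Euc d, ℂ)) :
    sobolevNorm r u ^ 2 = ∫ η, ‖ft u η‖ ^ 2 * (1 + ‖(2 * Real.pi) • η‖ ^ 2) ^ r := by
  have h := integral_comp_equiv (smulEquiv (2 * Real.pi) two_pi_ne_zero)
    (fun ξ : Euc d => ‖hat u ξ‖ ^ 2 * (1 + ‖ξ‖ ^ 2) ^ r)
  rw [absDet_smulEquiv, abs_of_pos (by positivity)] at h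
  have h2 : (∫ η, ‖ft u η‖ ^ 2 * (1 + ‖(2 * Real.pi) • η‖ ^ 2) ^ r) =
    ((2 * Real.pi) ^ d)⁻¹ • ∫ (x : Euc d), ‖hat u x‖ ^ 2 * (1 + ‖x‖ ^ 2) ^ r := h
  rw [h2, sobolevNorm, mul_pow, Real.sq_sqrt (integral_nonneg fun x => by positivity), smul_eq_mul]
  congr 1
  rw [← Real.rpow_natCast, ← Real.rpow_mul (by positivity), ← Real.rpow_natCast,
    ← Real.rpow_neg (by positivity)]
  congr 1
  push_cast
  ring

theorem sobolevNorm_nonneg (r : ℝ) (u : 𝓢'(Euc d, ℂ)) : 0 ≤ sobolevNorm r u := by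
  unfold sobolevNorm; positivity

/-! ### Unfolding integrals over the lattice -/

@[simp] theorem lat_apply (k : Fin d → ℤ) (i : Fin d) : lat k i = (k i : ℝ) := rfl

theorem lat_add (k l : Fin d → ℤ) : lat (k + l) = lat k + lat l := by ext i; simp

theorem lat_neg (k : Fin d → ℤ) : lat (-k) = -lat k := by ext i; simp

/-- The half-open unit cube. -/
def cube (d : ℕ) : Set (Euc d) := {x | ∀ i, x i ∈ Set.Ioc (0 : ℝ) 1}

theorem measurableSet_cube : MeasurableSet (cube d) := by
  have : cube d = ⋂ i, (fun x : Euc d => x i) ⁻¹' Set.Ioc (0 : ℝ) 1 := by ext; simp [cube]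
  rw [this]
  exact MeasurableSet.iInter fun i => measurableSet_Ioc.preimage (by fun_prop)

/-- Lebesgue measure on the unit cube. -/
abbrev cubeMeasure (d : ℕ) : Measure (Euc d) := volume.restrict (cube d)

/-- The lattice point `k` for which `x - k` lies in the unit cube. -/
def cubeIndex (x : Euc d) : Fin d → ℤ := fun i => ⌈x i⌉ - 1

/-- The representative of `x` modulo `ℤᵈ` in the unit cube. -/
def cubePart (x : Euc d) : Euc d := x - lat (cubeIndex x)

theorem cubePart_mem (x : Euc d) : cubePart x ∈ cube d := by
  intro i
  simp only [cubePart, PiLp.sub_apply, lat_apply, cubeIndex, Set.mem_Ioc]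
  have h1 := Int.ceil_lt_add_one (x i)
  have h2 := Int.le_ceil (x i)
  push_cast
  constructor <;> linarith

theorem cubeIndex_add_lat {x : Euc d} (hx : x ∈ cube d) (k : Fin d → ℤ) :
    cubeIndex (x + lat k) = k := by
  ext i
  have h : ⌈x i⌉ = 1 := by
    rw [Int.ceil_eq_iff]; have := hx i; simp at this; simpa using this
  simp [cubeIndex, h]

theorem cubePart_add_lat {x : Euc d} (hx : x ∈ cube d) (k : Fin d → ℤ) :
    cubePart (x + lat k) = x := by
  rw [cubePart, cubeIndex_add_lat hx, add_sub_cancel_right]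

theorem cubePart_add_cubeIndex (x : Euc d) : cubePart x + lat (cubeIndex x) = x := by
  simp [cubePart]

theorem measurable_cubePart : Measurable (cubePart : Euc d → Euc d) := by
  refine measurable_id.sub ?_
  refine (WithLp.measurable_toLp 2 (Fin d → ℝ)).comp (measurable_pi_lambda _ fun i => ?_)
  have : Measurable fun x : Euc d => x i := by fun_prop
  have h2 : Measurable fun z : ℤ => ((z - 1 : ℤ) : ℝ) := measurable_of_countable _
  exact h2.comp (Int.measurable_ceil.comp this)

theorem iUnion_cube : ⋃ k : Fin d → ℤ, (fun x => x - lat k) ⁻¹' cube d = Set.univ := by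
  refine Set.eq_univ_of_forall fun x => Set.mem_iUnion.2 ⟨cubeIndex x, cubePart_mem x⟩

theorem pairwise_disjoint_cube :
    Pairwise (Function.onFun Disjoint fun k : Fin d → ℤ => (fun x => x - lat k) ⁻¹' cube d) := by
  intro k l hkl
  rw [Function.onFun, Set.disjoint_left]
  intro x hk hl
  have h1 := cubeIndex_add_lat hk k
  have h2 := cubeIndex_add_lat hl l
  simp only [sub_add_cancel] at h1 h2
  exact hkl (h1.symm.trans h2)

/-- The translates of the half-open cube tile space without overlap, so the integral is a sum over
tiles, each moved back to the cube. -/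
theorem lintegral_eq_lintegral_cube {F : Euc d → ℝ≥0∞} (hF : AEMeasurable F) :
    ∫⁻ x, F x = ∫⁻ x in cube d, ∑' k : Fin d → ℤ, F (x + lat k) := by
  rw [← setLIntegral_univ, ← iUnion_cube, lintegral_iUnion
    (fun k => measurableSet_cube.preimage (by fun_prop)) pairwise_disjoint_cube,
    lintegral_tsum]
  · refine tsum_congr fun k => ?_
    have := (measurePreserving_add_right (volume : Measure (Euc d)) (lat k)).setLIntegral_comp_emb
      (measurableEmbedding_addRight (lat k)) F (cube d)
    rw [this]
    congr 2
    ext x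
    simp [sub_eq_add_neg]
  · intro k
    exact (hF.comp_quasiMeasurePreserving
      (measurePreserving_add_right volume (lat k)).quasiMeasurePreserving).restrict

theorem ae_add_right {p : Euc d → Prop} (h : ∀ᵐ x, p x) (y : Euc d) : ∀ᵐ x, p (x + y) :=
  (measurePreserving_add_right volume y).quasiMeasurePreserving.ae h

theorem ae_forall_add_lat {p : Euc d → Prop} (h : ∀ᵐ x, p x) :
    ∀ᵐ x, ∀ k : Fin d → ℤ, p (x + lat k) := ae_all_iff.2 fun k => ae_add_right h (lat k)

/-- Null sets of the cube extend periodically to null sets. -/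
theorem ae_cubePart {p : Euc d → Prop} (h : ∀ᵐ x ∂cubeMeasure d, p x) : ∀ᵐ x, p (cubePart x) := by
  rw [ae_restrict_iff' measurableSet_cube] at h
  have := ae_all_iff.2 fun k : Fin d → ℤ => ae_add_right h (-lat k)
  filter_upwards [this] with x hx
  have := hx (cubeIndex x)
  rw [← sub_eq_add_neg] at this
  exact this (cubePart_mem x)

/-- The periodization of a function. -/
def periodize (G : Euc d → ℂ) (x : Euc d) : ℂ := ∑' k : Fin d → ℤ, G (x + lat k)

theorem periodize_add_lat (G : Euc d → ℂ) (x : Euc d) (k : Fin d → ℤ) :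
    periodize G (x + lat k) = periodize G x := by
  unfold periodize
  rw [← (Equiv.addLeft k).tsum_eq (fun l => G (x + lat l))]
  refine tsum_congr fun l => ?_
  rw [Equiv.coe_addLeft, lat_add, add_assoc]

theorem periodize_cubePart (G : Euc d → ℂ) (x : Euc d) :
    periodize G (cubePart x) = periodize G x := by
  rw [cubePart, sub_eq_add_neg, ← lat_neg, periodize_add_lat]

theorem tsum_lintegral_cube_enorm {G : Euc d → ℂ} (hG : AEStronglyMeasurable G) :
    ∑' k : Fin d → ℤ, ∫⁻ x in cube d, ‖G (x + lat k)‖ₑ = ∫⁻ x, ‖G x‖ₑ := by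
  rw [lintegral_eq_lintegral_cube hG.enorm, lintegral_tsum]
  intro k
  exact (hG.enorm.comp_quasiMeasurePreserving
      (measurePreserving_add_right volume (lat k)).quasiMeasurePreserving).restrict

/-- The sum of the norms has finite integral over the cube, hence is finite a.e. there. Reindexing
by the lattice part of `x` extends this to all of space. -/
theorem ae_summable_add_lat {G : Euc d → ℂ} (hG : Integrable G) :
    ∀ᵐ x, Summable fun k : Fin d → ℤ => ‖G (x + lat k)‖ := by
  have h1 : ∀ᵐ x ∂cubeMeasure d, ∑' k : Fin d → ℤ, ‖G (x + lat k)‖ₑ < ⊤ := by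
    refine ae_lt_top' ?_ ?_
    · exact AEMeasurable.tsum fun k => (hG.1.enorm.comp_quasiMeasurePreserving
        (measurePreserving_add_right volume (lat k)).quasiMeasurePreserving).restrict
    · rw [← lintegral_eq_lintegral_cube hG.1.enorm]
      exact hG.2.ne
  filter_upwards [ae_cubePart h1] with x hx
  have h2 : Summable fun k : Fin d → ℤ => ‖G (cubePart x + lat k)‖ := by
    have h3 := ENNReal.summable_toReal hx.ne
    simpa using h3
  refine ((Equiv.addLeft (cubeIndex x)).summable_iff.2 h2).congr fun k => ?_
  rw [Function.comp_apply, Equiv.coe_addLeft, lat_add, ← add_assoc, cubePart_add_cubeIndex]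

theorem integral_eq_integral_cube {G : Euc d → ℂ} (hG : Integrable G) :
    ∫ x, G x = ∫ x in cube d, periodize G x := by
  unfold periodize
  rw [integral_tsum]
  · rw [← setIntegral_univ, ← iUnion_cube, integral_iUnion
      (fun k => measurableSet_cube.preimage (by fun_prop)) pairwise_disjoint_cube hG.integrableOn]
    refine tsum_congr fun k => ?_
    have := (measurePreserving_add_right (volume : Measure (Euc d)) (lat k)).setIntegral_image_emb
      (measurableEmbedding_addRight (lat k)) G (cube d)
    rw [← this]
    congr 2
    ext x
    simp [sub_eq_add_neg]
  · intro k
    exact (hG.1.comp_quasiMeasurePreserving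
      (measurePreserving_add_right volume (lat k)).quasiMeasurePreserving).restrict
  · rw [tsum_lintegral_cube_enorm hG.1]
    exact hG.2.ne

theorem aestronglyMeasurable_periodize {G : Euc d → ℂ} (hG : Integrable G) :
    AEStronglyMeasurable (periodize G) := by
  have hm : ∀ k : Fin d → ℤ, AEStronglyMeasurable (fun x => G (x + lat k)) := fun k =>
    hG.1.comp_quasiMeasurePreserving
      (measurePreserving_add_right volume (lat k)).quasiMeasurePreserving
  refine aestronglyMeasurable_of_tendsto_ae (Filter.atTop : Filter (Finset (Fin d → ℤ)))
    (f := fun s x => ∑ k ∈ s, G (x + lat k))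
    (fun s => Finset.aestronglyMeasurable_fun_sum s fun k _ => hm k) ?_
  filter_upwards [ae_summable_add_lat hG] with x hx
  exact hx.of_norm.hasSum

/-! ### Fourier series on the cube -/

section Torus

attribute [local instance] instMeasureSpaceUnitAddCircle

/-- The lift of the torus to the unit cube. -/
def torusLift (t : UnitAddTorus (Fin d)) : Euc d :=
  WithLp.toLp 2 (UnitAddTorus.measurableEquivPiIoc (0 : Fin d → ℝ) t).1

theorem measurePreserving_torusLift :
    MeasurePreserving (torusLift : UnitAddTorus (Fin d) → Euc d) volume (cubeMeasure d) := by
  set S : Set (Fin d → ℝ) := {x | ∀ i, x i ∈ Set.Ioc ((0 : Fin d → ℝ) i) ((0 : Fin d → ℝ) i + 1)}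
  have hSQ : WithLp.toLp 2 ⁻¹' cube d = S := by
    ext x; simp [cube, S]
  have h1 := (PiLp.volume_preserving_toLp (Fin d)).restrict_preimage
    (measurableSet_cube (d := d))
  rw [hSQ] at h1
  have hS : MeasurableSet S := by
    rw [← hSQ]; exact measurableSet_cube.preimage (WithLp.measurable_toLp 2 _)
  exact h1.comp ((measurePreserving_subtype_coe hS).comp
    (UnitAddTorus.measurePreserving_equivPiIoc (0 : Fin d → ℝ)))

theorem chr_lat_torusLift (k : Fin d → ℤ) (t : UnitAddTorus (Fin d)) :
    chr (lat k) (torusLift t) = UnitAddTorus.mFourier k t := by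
  have ht : t = fun i => ((torusLift t i : ℝ) : UnitAddCircle) := by
    have := (UnitAddTorus.measurableEquivPiIoc (0 : Fin d → ℝ)).symm_apply_apply t
    rw [UnitAddTorus.coe_symm_measurableEquivPiIoc_apply] at this
    exact this.symm
  conv_rhs => rw [ht]
  simp only [UnitAddTorus.mFourier, ContinuousMap.coe_mk, fourier_coe_apply, ← Complex.exp_sum, chr]
  congr 1
  rw [PiLp.inner_apply]
  simp only [lat_apply, RCLike.inner_apply, conj_trivial]
  push_cast
  rw [Finset.mul_sum, Finset.sum_mul]
  refine Finset.sum_congr rfl fun i _ => ?_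
  ring

/-- `L²` functions on the unit cube. -/
abbrev CubeL2 (d : ℕ) : Type := Lp ℂ 2 (cubeMeasure d)

instance : IsFiniteMeasure (cubeMeasure d) := by
  have h := measurePreserving_torusLift (d := d)
  constructor
  rw [← h.map_eq, Measure.map_apply h.measurable MeasurableSet.univ, Set.preimage_univ]
  have : IsProbabilityMeasure (volume : Measure UnitAddCircle) :=
    inferInstanceAs (IsProbabilityMeasure AddCircle.haarAddCircle)
  exact measure_lt_top _ _

theorem memLp_chr (y : Euc d) : MemLp (chr y) 2 (cubeMeasure d) :=
  MemLp.of_bound (continuous_chr y).aestronglyMeasurable 1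
    (Filter.Eventually.of_forall fun x => (norm_chr y x).le)

/-- The exponential `η ↦ exp(-2πi k·η)` on the unit cube. -/
def cubeExp (k : Fin d → ℤ) : CubeL2 d := (memLp_chr (-lat k)).toLp _

theorem inner_cubeExp (k : Fin d → ℤ) (H : CubeL2 d) :
    inner ℂ (cubeExp k) H = ∫ x in cube d, chr (lat k) x * H x := by
  rw [L2.inner_def]
  refine integral_congr_ae ?_
  filter_upwards [(memLp_chr (-lat k)).coeFn_toLp] with x hx
  rw [cubeExp, hx, RCLike.inner_apply, chr_neg, Complex.conj_conj, mul_comm]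

/-- Pull-back of square integrable functions from the cube to the torus. -/
def cubePullback (d : ℕ) : CubeL2 d →ₗᵢ[ℂ] Lp ℂ 2 (volume : Measure (UnitAddTorus (Fin d))) :=
  Lp.compMeasurePreservingₗᵢ ℂ torusLift measurePreserving_torusLift

/-- `cubeExp k` carries a minus sign so that the coefficient along it is `∫ e^{2πi k·η} H`, the
sample at `+k`. This is why the torus index is `-k`. -/
theorem cubePullback_cubeExp (k : Fin d → ℤ) :
    cubePullback d (cubeExp k) = UnitAddTorus.mFourierLp 2 (-k) := by
  refine Lp.ext ?_
  have h1 : (cubePullback d (cubeExp k) : UnitAddTorus (Fin d) → ℂ) =ᵐ[volume]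
      (cubeExp k) ∘ torusLift := Lp.coeFn_compMeasurePreserving _ _
  have h2 := measurePreserving_torusLift.quasiMeasurePreserving.ae
    (memLp_chr (-lat k)).coeFn_toLp
  filter_upwards [h1, h2, UnitAddTorus.coeFn_mFourierLp 2 (-k)] with t h1 h2 h3
  rw [h1, h3, Function.comp_apply, cubeExp, h2, ← lat_neg, chr_lat_torusLift]

theorem orthonormal_cubeExp : Orthonormal ℂ (cubeExp : (Fin d → ℤ) → CubeL2 d) := by
  have h : Orthonormal ℂ ((cubePullback d) ∘ (cubeExp : (Fin d → ℤ) → CubeL2 d)) := by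
    have : (cubePullback d) ∘ (cubeExp : (Fin d → ℤ) → CubeL2 d) =
        UnitAddTorus.mFourierLp 2 ∘ (fun k => -k) := by
      ext k : 1
      exact cubePullback_cubeExp k
    rw [this]
    exact UnitAddTorus.orthonormal_mFourier.comp _ neg_injective
  exact (LinearIsometry.orthonormal_comp_iff (cubePullback d)).1 h

/-- Completeness is inherited from the torus. Only injectivity of the pull-back is needed, since all
torus coefficients of the image vanish. -/
theorem eq_zero_of_inner_cubeExp (H : CubeL2 d) (h : ∀ k, inner ℂ (cubeExp k) H = 0) : H = 0 := by
  have h1 : cubePullback d H = 0 := by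
    rw [← UnitAddTorus.mFourierBasis.repr.map_eq_zero_iff]
    ext k
    rw [HilbertBasis.repr_apply_apply, UnitAddTorus.coe_mFourierBasis, ← neg_neg k,
      ← cubePullback_cubeExp, LinearIsometry.inner_map_map, h]
    rfl
  exact (cubePullback d).injective (h1.trans (map_zero _).symm)

/-- The exponentials form a Hilbert basis of the square integrable functions on the cube. -/
def cubeBasis (d : ℕ) : HilbertBasis (Fin d → ℤ) ℂ (CubeL2 d) :=
  HilbertBasis.mkOfOrthogonalEqBot orthonormal_cubeExp (by
    rw [Submodule.eq_bot_iff]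
    intro H hH
    refine eq_zero_of_inner_cubeExp H fun k => ?_
    exact (Submodule.mem_orthogonal _ _).1 hH _ (Submodule.subset_span ⟨k, rfl⟩))

theorem coe_cubeBasis : ⇑(cubeBasis d) = cubeExp := HilbertBasis.coe_mkOfOrthogonalEqBot _ _

theorem cubeBasis_repr (H : CubeL2 d) (k : Fin d → ℤ) :
    (cubeBasis d).repr H k = ∫ x in cube d, chr (lat k) x * H x := by
  rw [HilbertBasis.repr_apply_apply, coe_cubeBasis, inner_cubeExp]

end Torus

/-! ### Periodizations of functions with weighted square integrability -/

theorem one_add_sq_pos (x : Euc d) : (0 : ℝ) < 1 + ‖x‖ ^ 2 := by positivity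

theorem continuous_weight (t : ℝ) : Continuous fun x : Euc d => ((1 + ‖x‖ ^ 2) ^ t : ℝ) :=
  Continuous.rpow_const (by fun_prop) fun x => Or.inl (one_add_sq_pos x).ne'

theorem norm_le_sqrt_of_mem_cube {x : Euc d} (hx : x ∈ cube d) : ‖x‖ ^ 2 ≤ d := by
  rw [EuclideanSpace.norm_sq_eq]
  calc ∑ i, ‖x i‖ ^ 2 ≤ ∑ _i : Fin d, (1 : ℝ) := by
        refine Finset.sum_le_sum fun i _ => ?_
        have := hx i
        rw [Real.norm_eq_abs, sq_abs]
        have h1 := this.1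
        have h2 := this.2
        nlinarith
    _ = d := by simp

theorem volume_cube : (volume : Measure (Euc d)) (cube d) = 1 := by
  have h : (WithLp.toLp 2 ⁻¹' cube d) = Set.pi Set.univ fun _ : Fin d => Set.Ioc (0 : ℝ) 1 := by
    ext x; simp [cube, Set.mem_pi]
  rw [← (PiLp.volume_preserving_toLp (Fin d)).measure_preimage
    measurableSet_cube.nullMeasurableSet, h, volume_pi_pi]
  simp

/-- Within one lattice translate of the cube the weight varies by a bounded factor. The constant
comes from `2(‖x‖ + ‖y‖)² ≤ 8d`. -/
theorem one_add_norm_sq_le {x y k : Euc d} (hx : x ∈ cube d) (hy : y ∈ cube d) :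
    1 + ‖x + k‖ ^ 2 ≤ (2 + 8 * d) * (1 + ‖y + k‖ ^ 2) := by
  have h1 := norm_le_sqrt_of_mem_cube hx
  have h2 := norm_le_sqrt_of_mem_cube hy
  have h3 : ‖x + k‖ ≤ ‖y + k‖ + (‖x‖ + ‖y‖) := by
    have : x + k = (y + k) + (x - y) := by abel
    rw [this]
    exact (norm_add_le _ _).trans (by gcongr; exact norm_sub_le _ _)
  have h4 : ‖x + k‖ ^ 2 ≤ (‖y + k‖ + (‖x‖ + ‖y‖)) ^ 2 := by gcongr
  have h5 : (0 : ℝ) ≤ d := Nat.cast_nonneg _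
  nlinarith [sq_nonneg (‖y + k‖ - (‖x‖ + ‖y‖)), sq_nonneg (‖x‖ - ‖y‖), sq_nonneg ‖y + k‖,
    mul_nonneg h5 (sq_nonneg ‖y + k‖)]

/-- The sum at `x` is comparable to the sum at any other `y` in the cube. Averaging over `y` and
unfolding bounds it by a multiple of `∫ (1+‖y‖²)^{-s}`, finite since `2s > d`. -/
theorem exists_tsum_weight_le {s : ℝ} (hs : (d : ℝ) / 2 < s) : ∃ C : ℝ, 0 < C ∧
    ∀ x ∈ cube d, ∑' k : Fin d → ℤ, ENNReal.ofReal ((1 + ‖x + lat k‖ ^ 2) ^ (-s)) ≤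
      ENNReal.ofReal C := by
  have hs0 : 0 < s := lt_of_le_of_lt (by positivity) hs
  have hint : Integrable fun x : Euc d => (1 + ‖x‖ ^ 2) ^ (-s) := by
    have := integrable_rpow_neg_one_add_norm_sq (E := Euc d) (μ := volume) (r := 2 * s)
      (by simp; linarith)
    refine this.congr (Filter.Eventually.of_forall fun x => ?_)
    simp only
    congr 1
    ring
  set I : ℝ≥0∞ := ∫⁻ x : Euc d, ENNReal.ofReal ((1 + ‖x‖ ^ 2) ^ (-s)) with hI
  have hI' : I < ⊤ := hint.lintegral_lt_top
  have hm : ∀ k : Fin d → ℤ, Measurable fun x : Euc d =>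
      ENNReal.ofReal ((1 + ‖x + lat k‖ ^ 2) ^ (-s)) := fun k =>
    (((continuous_weight (-s)).comp (continuous_add_const (lat k))).measurable).ennreal_ofReal
  set K : ℝ := (2 + 8 * d) ^ s with hK
  have hKpos : 0 < K := by positivity
  refine ⟨(ENNReal.ofReal K * I).toReal + 1, by positivity, fun x hx => ?_⟩
  have key : ∀ y ∈ cube d, ∑' k : Fin d → ℤ, ENNReal.ofReal ((1 + ‖x + lat k‖ ^ 2) ^ (-s)) ≤
      ∑' k : Fin d → ℤ, ENNReal.ofReal K * ENNReal.ofReal ((1 + ‖y + lat k‖ ^ 2) ^ (-s)) := by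
    intro y hy
    refine ENNReal.tsum_le_tsum fun k => ?_
    rw [← ENNReal.ofReal_mul hKpos.le]
    refine ENNReal.ofReal_le_ofReal ?_
    have h := one_add_norm_sq_le (k := lat k) hy hx
    rw [Real.rpow_neg (one_add_sq_pos _).le, Real.rpow_neg (one_add_sq_pos _).le, ← div_eq_mul_inv,
      inv_eq_one_div, div_le_div_iff₀ (Real.rpow_pos_of_pos (one_add_sq_pos _) _)
      (Real.rpow_pos_of_pos (one_add_sq_pos _) _), one_mul, hK,
      ← Real.mul_rpow (by positivity) (one_add_sq_pos _).le]
    exact Real.rpow_le_rpow (one_add_sq_pos _).le h hs0.le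
  have h1 : ∑' k : Fin d → ℤ, ENNReal.ofReal ((1 + ‖x + lat k‖ ^ 2) ^ (-s)) ≤
      ENNReal.ofReal K * I := by
    -- The cube has volume one, so averaging a constant over it changes nothing.
    calc _ = ∫⁻ _y in cube d, ∑' k : Fin d → ℤ, ENNReal.ofReal ((1 + ‖x + lat k‖ ^ 2) ^ (-s)) := by
          rw [setLIntegral_const, volume_cube, mul_one]
      _ ≤ ∫⁻ y in cube d, ∑' k : Fin d → ℤ,
          ENNReal.ofReal K * ENNReal.ofReal ((1 + ‖y + lat k‖ ^ 2) ^ (-s)) :=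
          setLIntegral_mono (Measurable.tsum fun k => (hm k).const_mul _) key
      _ = ENNReal.ofReal K * I := by
          simp_rw [ENNReal.tsum_mul_left]
          rw [lintegral_const_mul _ (Measurable.tsum hm), hI,
            lintegral_eq_lintegral_cube (continuous_weight (-s)).measurable.ennreal_ofReal.aemeasurable]
  refine h1.trans ?_
  rw [← ENNReal.ofReal_toReal (ENNReal.mul_ne_top ENNReal.ofReal_ne_top hI'.ne)]
  exact ENNReal.ofReal_le_ofReal (by simp)

/-- Cauchy–Schwarz, read off from Hölder's inequality for the counting measure. -/
theorem tsum_mul_sq_le {ι : Type*} [Countable ι] (f g : ι → ℝ≥0∞) :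
    (∑' i, f i * g i) ^ 2 ≤ (∑' i, f i ^ 2) * ∑' i, g i ^ 2 := by
  let _ : MeasurableSpace ι := ⊤
  have h := ENNReal.lintegral_mul_le_Lp_mul_Lq (Measure.count : Measure ι)
    (Real.HolderConjugate.two_two) (f := f) (g := g) (measurable_of_countable _).aemeasurable
    (measurable_of_countable _).aemeasurable
  simp only [lintegral_count, Pi.mul_apply] at h
  have h2 := pow_le_pow_left' h 2
  refine h2.trans_eq ?_
  rw [mul_pow, ← ENNReal.rpow_natCast, ← ENNReal.rpow_natCast, ← ENNReal.rpow_mul,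
    ← ENNReal.rpow_mul]
  simp

theorem integrable_of_memLp_weight {s : ℝ} (hs : (d : ℝ) / 2 < s) {G : Euc d → ℂ}
    (hG : MemLp (fun x => ((1 + ‖x‖ ^ 2) ^ (s / 2) : ℝ) * G x) 2 volume) : Integrable G := by
  have hw : MemLp (fun x : Euc d => (((1 + ‖x‖ ^ 2) ^ (-s / 2) : ℝ) : ℂ)) 2 volume := by
    refine MemLp.ofReal (K := ℂ) (f := fun x : Euc d => ((1 + ‖x‖ ^ 2) ^ (-s / 2) : ℝ)) ?_
    rw [memLp_two_iff_integrable_sq (continuous_weight (-s / 2)).aestronglyMeasurable]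
    have := integrable_rpow_neg_one_add_norm_sq (E := Euc d) (μ := volume) (r := 2 * s)
      (by simp; linarith)
    refine this.congr (Filter.Eventually.of_forall fun x => ?_)
    simp only
    rw [← Real.rpow_mul_natCast (one_add_sq_pos x).le]
    congr 1
    push_cast
    ring
  refine (hw.integrable_mul hG).congr (Filter.Eventually.of_forall fun x => ?_)
  simp only [Pi.mul_apply]
  rw [← mul_assoc, ← Complex.ofReal_mul, ← Real.rpow_add (one_add_sq_pos x)]
  simp [neg_div]

theorem sq_weight (s : ℝ) (G : Euc d → ℂ) (x : Euc d) :
    ‖(((1 + ‖x‖ ^ 2) ^ (s / 2) : ℝ) : ℂ) * G x‖ ^ 2 = ‖G x‖ ^ 2 * (1 + ‖x‖ ^ 2) ^ s := by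
  rw [norm_mul, mul_pow, Complex.norm_real, Real.norm_eq_abs, sq_abs, ← Real.rpow_natCast,
    ← Real.rpow_mul (one_add_sq_pos x).le, mul_comm]
  congr 2
  push_cast
  ring

theorem lintegral_sq_enorm_toLp {α : Type*} [MeasurableSpace α] {μ : Measure α} {f : α → ℂ}
    (hf : MemLp f 2 μ) : ENNReal.ofReal (‖hf.toLp f‖ ^ 2) = ∫⁻ x, ‖f x‖ₑ ^ 2 ∂μ := by
  rw [Lp.norm_toLp, ENNReal.ofReal_pow ENNReal.toReal_nonneg, ENNReal.ofReal_toReal hf.2.ne,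
    eLpNorm_eq_lintegral_rpow_enorm_toReal (by norm_num) (by norm_num), ← ENNReal.rpow_natCast,
    ← ENNReal.rpow_mul]
  simp

theorem lintegral_sq_enorm_Lp {α : Type*} [MeasurableSpace α] {μ : Measure α} (f : Lp ℂ 2 μ) :
    ENNReal.ofReal (‖f‖ ^ 2) = ∫⁻ x, ‖f x‖ₑ ^ 2 ∂μ := by
  rw [← lintegral_sq_enorm_toLp (Lp.memLp f), Lp.toLp_coeFn]

theorem memLp_two_of_lintegral_lt_top {α : Type*} [MeasurableSpace α] {μ : Measure α} {f : α → ℂ}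
    (hm : AEStronglyMeasurable f μ) (hf : ∫⁻ x, ‖f x‖ₑ ^ 2 ∂μ < ⊤) : MemLp f 2 μ := by
  refine ⟨hm, ?_⟩
  rw [eLpNorm_lt_top_iff_lintegral_rpow_enorm_lt_top (by norm_num) (by norm_num)]
  simpa using hf

/-- Write `G` as the inverse weight times the weighted function `F` and apply Cauchy–Schwarz to the
sum over `k`. The weight sum is uniformly bounded on the cube, and the sum of `‖F‖²` unfolds to an
integral over all of space. -/
theorem exists_periodize_bound {s : ℝ} (hs : (d : ℝ) / 2 < s) : ∃ C : ℝ, 0 < C ∧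
    ∀ G : Euc d → ℂ, MemLp (fun x => ((1 + ‖x‖ ^ 2) ^ (s / 2) : ℝ) * G x) 2 volume →
      ∃ hP : MemLp (periodize G) 2 (cubeMeasure d),
        ‖hP.toLp _‖ ^ 2 ≤ C * ∫ x, ‖G x‖ ^ 2 * (1 + ‖x‖ ^ 2) ^ s := by
  obtain ⟨C, hC, hCle⟩ := exists_tsum_weight_le hs
  refine ⟨C, hC, fun G hG => ?_⟩
  have hGi := integrable_of_memLp_weight hs hG
  set F : Euc d → ℂ := fun x => ((1 + ‖x‖ ^ 2) ^ (s / 2) : ℝ) * G x with hF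
  have hbound : ∫⁻ x in cube d, ‖periodize G x‖ₑ ^ 2 ≤
      ENNReal.ofReal C * ∫⁻ x, ‖F x‖ₑ ^ 2 := by
    rw [lintegral_eq_lintegral_cube (F := fun x => ‖F x‖ₑ ^ 2) (hG.1.enorm.pow_const 2),
      ← lintegral_const_mul' _ _ ENNReal.ofReal_ne_top]
    refine setLIntegral_mono' measurableSet_cube fun x hx => ?_
    have hterm : ∀ k : Fin d → ℤ, ‖G (x + lat k)‖ₑ =
        ENNReal.ofReal ((1 + ‖x + lat k‖ ^ 2) ^ (-s / 2)) * ‖F (x + lat k)‖ₑ := fun k => by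
      rw [hF, enorm_mul, ← mul_assoc, ← ofReal_norm (((_ : ℝ) : ℂ)), Complex.norm_real,
        Real.norm_of_nonneg (Real.rpow_nonneg (one_add_sq_pos _).le _),
        ← ENNReal.ofReal_mul (Real.rpow_nonneg (one_add_sq_pos _).le _),
        ← Real.rpow_add (one_add_sq_pos _)]
      simp [neg_div]
    calc ‖periodize G x‖ₑ ^ 2 ≤ (∑' k : Fin d → ℤ, ‖G (x + lat k)‖ₑ) ^ 2 := by
          gcongr
          exact enorm_tsum_le_tsum_enorm
      _ = (∑' k : Fin d → ℤ, ENNReal.ofReal ((1 + ‖x + lat k‖ ^ 2) ^ (-s / 2)) *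
            ‖F (x + lat k)‖ₑ) ^ 2 := by simp_rw [hterm]
      _ ≤ (∑' k : Fin d → ℤ, ENNReal.ofReal ((1 + ‖x + lat k‖ ^ 2) ^ (-s / 2)) ^ 2) *
            ∑' k : Fin d → ℤ, ‖F (x + lat k)‖ₑ ^ 2 := tsum_mul_sq_le _ _
      _ ≤ _ := by
          gcongr
          refine le_trans (le_of_eq ?_) (hCle x hx)
          refine tsum_congr fun k => ?_
          rw [← ENNReal.ofReal_pow (Real.rpow_nonneg (one_add_sq_pos _).le _),
            ← Real.rpow_natCast, ← Real.rpow_mul (one_add_sq_pos _).le]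
          congr 2
          push_cast
          ring
  have hFi : ∫⁻ x, ‖F x‖ₑ ^ 2 = ENNReal.ofReal (∫ x, ‖G x‖ ^ 2 * (1 + ‖x‖ ^ 2) ^ s) := by
    have h1 := (memLp_two_iff_integrable_sq_norm hG.1).1 hG
    simp only [hF] at h1
    simp_rw [← sq_weight s G]
    rw [ofReal_integral_eq_lintegral_ofReal h1 (Filter.Eventually.of_forall fun x => by positivity)]
    refine lintegral_congr fun x => ?_
    rw [ENNReal.ofReal_pow (norm_nonneg _), ofReal_norm]
  rw [hFi, ← ENNReal.ofReal_mul hC.le] at hbound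
  refine ⟨memLp_two_of_lintegral_lt_top (aestronglyMeasurable_periodize hGi).restrict
    (hbound.trans_lt ENNReal.ofReal_lt_top), ?_⟩
  rw [← lintegral_sq_enorm_toLp (memLp_two_of_lintegral_lt_top
    (aestronglyMeasurable_periodize hGi).restrict (hbound.trans_lt ENNReal.ofReal_lt_top))] at hbound
  refine (ENNReal.ofReal_le_ofReal_iff (mul_nonneg hC.le ?_)).1 hbound
  exact integral_nonneg fun x => mul_nonneg (by positivity)
    (Real.rpow_nonneg (one_add_sq_pos x).le _)

theorem chr_lat_lat (k l : Fin d → ℤ) : chr (lat k) (lat l) = 1 := by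
  rw [chr, PiLp.inner_apply, Complex.exp_eq_one_iff]
  refine ⟨∑ i, l i * k i, ?_⟩
  simp only [lat_apply, RCLike.inner_apply, conj_trivial]
  push_cast
  ring

/-- Characters with lattice frequency are ℤᵈ-periodic, hence pass through the periodization. -/
theorem integral_chr_mul {G : Euc d → ℂ} (hG : Integrable G) (k : Fin d → ℤ) :
    ∫ x, chr (lat k) x * G x = ∫ x in cube d, chr (lat k) x * periodize G x := by
  have hi : Integrable fun x => chr (lat k) x * G x :=
    hG.bdd_mul (continuous_chr _).aestronglyMeasurable
      (Filter.Eventually.of_forall fun x => (norm_chr (lat k) x).le)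
  rw [integral_eq_integral_cube hi]
  congr 1
  ext x
  unfold periodize
  rw [← tsum_mul_left]
  refine tsum_congr fun l => ?_
  simp only [chr_add_right, chr_lat_lat, mul_one]

/-- The link between sampling and Fourier series: lattice samples of the inverse transform of `G`
are the basis coefficients of its periodization. -/
theorem cubeBasis_repr_periodize {G : Euc d → ℂ} (hG : Integrable G)
    (hP : MemLp (periodize G) 2 (cubeMeasure d)) (k : Fin d → ℤ) :
    (cubeBasis d).repr (hP.toLp _) k = ∫ x, chr (lat k) x * G x := by
  rw [cubeBasis_repr, integral_chr_mul hG]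
  refine integral_congr_ae ?_
  filter_upwards [hP.coeFn_toLp] with x hx
  rw [hx]

/-! ### The synthesis operator -/

/-- Multiplication of the periodic extension of a square integrable function on the cube by a
function with bounded bracket. -/
theorem exists_synthesis {g : Euc d → ℂ} (hg : AEStronglyMeasurable g) {B : ℝ} (hB0 : 0 ≤ B)
    (hB : ∀ᵐ x, ∑' k : Fin d → ℤ, ‖g (x + lat k)‖ₑ ^ 2 ≤ ENNReal.ofReal B) :
    ∃ T : CubeL2 d →L[ℂ] L2 d, (∀ H : CubeL2 d, T H =ᵐ[volume] fun x => H (cubePart x) * g x) ∧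
      ∀ H, ‖T H‖ ≤ Real.sqrt B * ‖H‖ := by
  have hm : ∀ H : CubeL2 d, AEStronglyMeasurable fun x => H (cubePart x) * g x := fun H =>
    ((Lp.stronglyMeasurable H).comp_measurable measurable_cubePart).aestronglyMeasurable.mul hg
  have hb : ∀ H : CubeL2 d, ∫⁻ x, ‖H (cubePart x) * g x‖ₑ ^ 2 ≤
      ENNReal.ofReal (B * ‖H‖ ^ 2) := by
    intro H
    -- After unfolding, the factor `H` does not depend on the lattice point and the remaining sum is
    -- the bracket.
    rw [lintegral_eq_lintegral_cube ((hm H).enorm.pow_const 2), ENNReal.ofReal_mul hB0,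
      lintegral_sq_enorm_Lp, ← lintegral_const_mul' _ _ ENNReal.ofReal_ne_top]
    refine lintegral_mono_ae ?_
    filter_upwards [ae_restrict_of_ae hB, ae_restrict_mem measurableSet_cube] with x hx hxQ
    simp_rw [cubePart_add_lat hxQ, enorm_mul, mul_pow]
    rw [ENNReal.tsum_mul_left, mul_comm]
    gcongr
  have hL : ∀ H : CubeL2 d, MemLp (fun x => H (cubePart x) * g x) 2 volume := fun H =>
    memLp_two_of_lintegral_lt_top (hm H) ((hb H).trans_lt ENNReal.ofReal_lt_top)
  have hnorm : ∀ H : CubeL2 d, ‖(hL H).toLp _‖ ≤ Real.sqrt B * ‖H‖ := by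
    intro H
    have h := hb H
    rw [← lintegral_sq_enorm_toLp (hL H), ENNReal.ofReal_le_ofReal_iff (by positivity)] at h
    refine le_of_sq_le_sq (h.trans_eq ?_) (by positivity)
    rw [mul_pow, Real.sq_sqrt hB0]
  refine ⟨LinearMap.mkContinuous
    { toFun := fun H => (hL H).toLp _
      map_add' := fun H K => ?_
      map_smul' := fun c H => ?_ } (Real.sqrt B) hnorm, fun H => (hL H).coeFn_toLp, hnorm⟩
  · rw [← MemLp.toLp_add]
    refine MemLp.toLp_congr _ _ ?_
    filter_upwards [ae_cubePart (Lp.coeFn_add H K)] with x hx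
    rw [hx, Pi.add_apply, Pi.add_apply, add_mul]
  · rw [RingHom.id_apply, ← MemLp.toLp_const_smul]
    refine MemLp.toLp_congr _ _ ?_
    filter_upwards [ae_cubePart (Lp.coeFn_smul c H)] with x hx
    rw [hx, Pi.smul_apply, Pi.smul_apply, smul_eq_mul, smul_eq_mul, mul_assoc]

/-- Composition with a linear automorphism on `L²`. -/
theorem exists_dilation (B : Euc d ≃L[ℝ] Euc d) : ∃ D : L2 d →L[ℂ] L2 d,
    (∀ f : L2 d, D f =ᵐ[volume] fun x => f (B x)) ∧
      ∀ f, ‖D f‖ = Real.sqrt (absDet B)⁻¹ * ‖f‖ := by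
  have hb : ∀ f : L2 d, ∫⁻ x, ‖f (B x)‖ₑ ^ 2 = ENNReal.ofReal ((absDet B)⁻¹ * ‖f‖ ^ 2) := by
    intro f
    rw [lintegral_comp_equiv B (fun x => ‖f x‖ₑ ^ 2), ← lintegral_sq_enorm_Lp,
      ENNReal.ofReal_mul (inv_nonneg.2 (absDet_pos B).le)]
  have hL : ∀ f : L2 d, MemLp (fun x => f (B x)) 2 volume := fun f =>
    memLp_two_of_lintegral_lt_top
      ((Lp.stronglyMeasurable f).comp_measurable B.continuous.measurable).aestronglyMeasurable
      ((hb f).trans_lt ENNReal.ofReal_lt_top)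
  have hnorm : ∀ f : L2 d, ‖(hL f).toLp _‖ = Real.sqrt (absDet B)⁻¹ * ‖f‖ := by
    intro f
    have h := hb f
    have hpos := absDet_pos B
    rw [← lintegral_sq_enorm_toLp (hL f), ENNReal.ofReal_eq_ofReal_iff (by positivity)
      (by positivity)] at h
    rw [← sq_eq_sq₀ (by positivity) (by positivity), h, mul_pow, Real.sq_sqrt (by positivity)]
  refine ⟨LinearMap.mkContinuous
    { toFun := fun f => (hL f).toLp _
      map_add' := fun f g => ?_
      map_smul' := fun c f => ?_ } (Real.sqrt (absDet B)⁻¹) (fun f => (hnorm f).le),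
      fun f => (hL f).coeFn_toLp, hnorm⟩
  · rw [← MemLp.toLp_add]
    refine MemLp.toLp_congr _ _ ?_
    exact (quasiMeasurePreserving_equiv B).ae (Lp.coeFn_add f g)
  · rw [RingHom.id_apply, ← MemLp.toLp_const_smul]
    refine MemLp.toLp_congr _ _ ?_
    exact (quasiMeasurePreserving_equiv B).ae (Lp.coeFn_smul c f)

/-! ### Isotropic dilation matrices -/

section Dilation

variable {M : Matrix (Fin d) (Fin d) ℤ}

/-- `x ↦ Mᵀ x` as a linear automorphism of `ℝᵈ`. -/
def IsIsotropicDilation.transposeEquiv (hM : IsIsotropicDilation M) : Euc d ≃L[ℝ] Euc d :=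
  LinearEquiv.toContinuousLinearEquiv
    { toFun := act (realMat M).transpose
      invFun := act (realMat M).transpose⁻¹
      map_add' := fun x y => by simp [act, Matrix.mulVec_add]
      map_smul' := fun c x => by simp [act, Matrix.mulVec_smul]
      left_inv := fun x => by
        simp [act, Matrix.mulVec_mulVec,
          Matrix.nonsing_inv_mul _ ((Matrix.det_transpose (realMat M)).symm ▸ hM.isUnit_det)]
      right_inv := fun x => by
        simp [act, Matrix.mulVec_mulVec,
          Matrix.mul_nonsing_inv _ ((Matrix.det_transpose (realMat M)).symm ▸ hM.isUnit_det)] }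

theorem IsIsotropicDilation.transposeEquiv_apply (hM : IsIsotropicDilation M) (x : Euc d) :
    hM.transposeEquiv x = act (realMat M).transpose x := rfl

theorem IsIsotropicDilation.transposeEquiv_symm_apply (hM : IsIsotropicDilation M) (x : Euc d) :
    hM.transposeEquiv.symm x = act (realMat M).transpose⁻¹ x := rfl

theorem IsIsotropicDilation.inner_equiv (hM : IsIsotropicDilation M) (x y : Euc d) :
    inner ℝ (hM.equiv x) y = inner ℝ x (hM.transposeEquiv y) := by
  have h1 : hM.equiv x = WithLp.toLp 2 ((realMat M).mulVec x.ofLp) := rfl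
  have h2 : hM.transposeEquiv y = WithLp.toLp 2 ((realMat M).transpose.mulVec y.ofLp) := rfl
  rw [h1, h2, EuclideanSpace.inner_eq_star_dotProduct, EuclideanSpace.inner_eq_star_dotProduct]
  simp [Matrix.dotProduct_mulVec, Matrix.mulVec_transpose]

theorem IsIsotropicDilation.isContragredient (hM : IsIsotropicDilation M) (N : ℕ) :
    IsContragredient (hM.equiv ^ N) (hM.transposeEquiv ^ N).symm := by
  have h : ∀ x y, inner ℝ ((hM.equiv ^ N) x) y = inner ℝ x ((hM.transposeEquiv ^ N) y) := by
    induction N with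
    | zero => intro x y; rfl
    | succ n ih =>
      intro x y
      rw [pow_succ', pow_succ]
      change inner ℝ (hM.equiv ((hM.equiv ^ n) x)) y =
        inner ℝ x ((hM.transposeEquiv ^ n) (hM.transposeEquiv y))
      rw [hM.inner_equiv, ih]
  intro x y
  rw [h, ContinuousLinearEquiv.apply_symm_apply]

theorem IsIsotropicDilation.absDet_equiv (hM : IsIsotropicDilation M) : absDet hM.equiv = |(M.det : ℝ)| := by
  have h : (hM.equiv.toLinearEquiv : Euc d →ₗ[ℝ] Euc d) =
      Matrix.toLin (EuclideanSpace.basisFun (Fin d) ℝ).toBasis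
        (EuclideanSpace.basisFun (Fin d) ℝ).toBasis (realMat M) := by
    refine (EuclideanSpace.basisFun (Fin d) ℝ).toBasis.ext fun i => ?_
    rw [Matrix.toLin_self]
    ext j
    rw [OrthonormalBasis.coe_toBasis, EuclideanSpace.basisFun_apply]
    have h1 : hM.equiv (EuclideanSpace.single i 1) =
      WithLp.toLp 2 ((realMat M).mulVec (EuclideanSpace.single i (1 : ℝ)).ofLp) := rfl
    change hM.equiv (EuclideanSpace.single i 1) j = _
    rw [h1]
    simp [Pi.single_apply]
  unfold absDet
  rw [h, LinearMap.det_toLin]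
  congr 1
  exact ((Int.castRingHom ℝ).map_det M).symm

theorem scale_pow (M : Matrix (Fin d) (Fin d) ℤ) (hd : 1 ≤ d) : scale M ^ d = |(M.det : ℝ)| := by
  rw [scale, ← Real.rpow_natCast, ← Real.rpow_mul (abs_nonneg _), one_div,
    inv_mul_cancel₀ (by positivity), Real.rpow_one]

theorem absDet_pow (A : Euc d ≃L[ℝ] Euc d) (N : ℕ) : absDet (A ^ N) = absDet A ^ N := by
  induction N with
  | zero =>
    have : ((A ^ 0).toLinearEquiv : Euc d →ₗ[ℝ] Euc d) = LinearMap.id := rfl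
    rw [absDet, this, LinearMap.det_id, abs_one, pow_zero]
  | succ n ih =>
    rw [pow_succ, pow_succ, ← ih]
    unfold absDet
    rw [← abs_mul, ← LinearMap.det_comp]
    rfl

/-- The diagonal entries of `D` are eigenvalues of `M` and have modulus `scale M`. The hypothesis `1
≤ d` provides an entry. -/
theorem IsIsotropicDilation.one_lt_scale (hM : IsIsotropicDilation M) (hd : 1 ≤ d) : 1 < scale M := by
  obtain ⟨P, D, hP, hD, hM', hs⟩ := hM.isotropic
  let i : Fin d := ⟨0, hd⟩
  rw [← hs i]
  apply hM.expanding
  have hPu : IsUnit P := (Matrix.isUnit_iff_isUnit_det P).2 hP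
  obtain ⟨U, rfl⟩ := hPu
  rw [hM', ← Matrix.coe_units_inv, spectrum.units_conjugate]
  obtain ⟨v, rfl⟩ : ∃ v, D = Matrix.diagonal v := ⟨_, ((Matrix.isDiag_iff_diagonal_diag D).1 hD).symm⟩
  rw [spectrum_diagonal]
  exact ⟨i, by simp⟩

/-- In eigencoordinates `Mᵀ` is diagonal with all entries of modulus `m`, so each application
stretches the sup norm by at least `m`. Norms are compared only before the first and after the last
application, which keeps `K` independent of `N`. -/
theorem IsIsotropicDilation.exists_norm_symm_le (hM : IsIsotropicDilation M) (hd : 1 ≤ d) : ∃ K : ℝ, 1 ≤ K ∧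
    ∀ (N : ℕ) (x : Euc d), ‖x‖ ≤ K * (scale M ^ N)⁻¹ * ‖(hM.transposeEquiv ^ N) x‖ := by
  obtain ⟨P, D, hP, hD, hM', hs⟩ := hM.isotropic
  have hscale := hM.one_lt_scale hd
  let c : Euc d →ₗ[ℝ] (Fin d → ℂ) :=
    { toFun := fun x i => (x i : ℂ)
      map_add' := fun x y => by ext i; simp
      map_smul' := fun a x => by ext i; simp }
  -- The coordinates are `Pᵀx`: from `MP = PD` one gets `PᵀMᵀ = DPᵀ`.
  let L : Euc d →ₗ[ℝ] (Fin d → ℂ) := (Matrix.mulVecLin P.transpose).restrictScalars ℝ ∘ₗ c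
  have hLapp : ∀ x, L x = P.transpose.mulVec (fun i => (x i : ℂ)) := fun x => rfl
  have hLinj : Function.Injective L := by
    have h1 : Function.Injective (P.transpose.mulVec) := by
      apply Matrix.mulVec_injective_of_isUnit
      rw [Matrix.isUnit_iff_isUnit_det, Matrix.det_transpose]
      exact hP
    intro x y hxy
    have := h1 hxy
    ext i
    have := congrFun this i
    exact Complex.ofReal_injective this
  obtain ⟨K₁, hK₁, hanti⟩ := L.exists_antilipschitzWith (LinearMap.ker_eq_bot.2 hLinj)
  have hstep : ∀ x, L (hM.transposeEquiv x) = D.mulVec (L x) := by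
    intro x
    have hcast : (fun i => ((hM.transposeEquiv x) i : ℂ)) =
        (M.map (Int.cast : ℤ → ℂ)).transpose.mulVec (fun i => (x i : ℂ)) := by
      ext i
      have h2 : (hM.transposeEquiv x) i = ((realMat M).transpose.mulVec x.ofLp) i := rfl
      rw [h2]
      simp [Matrix.mulVec, dotProduct, realMat]
    rw [hLapp, hLapp, hcast, Matrix.mulVec_mulVec, Matrix.mulVec_mulVec, ← Matrix.transpose_mul]
    have h3 : M.map (Int.cast : ℤ → ℂ) * P = P * D := by
      rw [hM', Matrix.mul_assoc, Matrix.nonsing_inv_mul _ hP, Matrix.mul_one]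
    have h4 : D.transpose = D := by
      conv_lhs => rw [← (Matrix.isDiag_iff_diagonal_diag D).1 hD]
      rw [Matrix.diagonal_transpose, (Matrix.isDiag_iff_diagonal_diag D).1 hD]
    rw [h3, Matrix.transpose_mul, h4]
  have hDn : ∀ z : Fin d → ℂ, scale M * ‖z‖ ≤ ‖D.mulVec z‖ := by
    intro z
    have hz : ∀ i, ‖D.mulVec z i‖ = scale M * ‖z i‖ := by
      intro i
      conv_lhs => rw [← (Matrix.isDiag_iff_diagonal_diag D).1 hD]
      rw [Matrix.mulVec_diagonal, norm_mul, Matrix.diag_apply, hs]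
    rw [← le_div_iff₀' (by linarith)]
    refine (pi_norm_le_iff_of_nonneg (by positivity)).2 fun i => ?_
    rw [le_div_iff₀' (by linarith), ← hz i]
    exact norm_le_pi_norm _ i
  have hpow : ∀ (N : ℕ) (x : Euc d), scale M ^ N * ‖L x‖ ≤ ‖L ((hM.transposeEquiv ^ N) x)‖ := by
    intro N
    induction N with
    | zero => intro x; rw [pow_zero, one_mul]; rfl
    | succ n ih =>
      intro x
      rw [pow_succ, pow_succ]
      change _ ≤ ‖L ((hM.transposeEquiv ^ n) (hM.transposeEquiv x))‖
      refine le_trans ?_ (ih _)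
      rw [mul_assoc, hstep]
      exact mul_le_mul_of_nonneg_left (hDn _) (by positivity)
  set K₂ := ‖LinearMap.toContinuousLinearMap L‖ with hK₂
  have hLle : ∀ x, ‖L x‖ ≤ K₂ * ‖x‖ := (LinearMap.toContinuousLinearMap L).le_opNorm
  refine ⟨max 1 (K₁ * K₂), le_max_left _ _, fun N x => ?_⟩
  have h1 : ‖x‖ ≤ K₁ * ‖L x‖ := by
    have := hanti.le_mul_dist x 0
    simpa using this
  have h2 : ‖L x‖ ≤ (scale M ^ N)⁻¹ * (K₂ * ‖(hM.transposeEquiv ^ N) x‖) := by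
    rw [← div_eq_inv_mul, le_div_iff₀' (by positivity)]
    exact (hpow N x).trans (hLle _)
  calc ‖x‖ ≤ K₁ * ((scale M ^ N)⁻¹ * (K₂ * ‖(hM.transposeEquiv ^ N) x‖)) :=
        h1.trans (mul_le_mul_of_nonneg_left h2 K₁.2)
    _ = (K₁ * K₂) * (scale M ^ N)⁻¹ * ‖(hM.transposeEquiv ^ N) x‖ := by ring
    _ ≤ _ := by gcongr; exact le_max_right _ _

end Dilation

variable {M : Matrix (Fin d) (Fin d) ℤ}

/-! ### The coefficients of the quasi-projection operators -/

/-- The function `η ↦ f̂((Mᵀ)ᴺ η) conj(v̂(η))` whose inverse Fourier transform is sampled by the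
analysis operator. -/
def dilatedProduct (hM : IsIsotropicDilation M) (f v : 𝓢'(Euc d, ℂ)) (N : ℕ) (η : Euc d) : ℂ :=
  ft f ((hM.transposeEquiv ^ N) η) * (starRingEnd ℂ) (ft v η)

/-- Substitute `(Mᵀ)ᴺη` for the frequency. The Jacobian cancels the determinant produced by dilating
the distribution, and conjugation turns the character of `-y` into that of `y`. -/
theorem pairing_dualAtom (hM : IsIsotropicDilation M) (s : ℝ) (f : 𝓢'(Euc d, ℂ))
    {v : 𝓢'(Euc d, ℂ)} (hv : IsFt v (ft v)) (N : ℕ) (y : Euc d) :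
    pairing f (dualAtom hM s v N y) =
      ((scale M ^ ((N : ℝ) * ((d : ℝ) / 2 + s)) : ℝ) : ℂ) *
        ∫ η, chr y η * dilatedProduct hM f v N η := by
  set A := hM.equiv ^ N with hA
  set AT := hM.transposeEquiv ^ N with hAT
  set c : ℝ := scale M ^ ((N : ℝ) * ((d : ℝ) / 2 + s)) with hc
  have hcon : IsContragredient A AT.symm := hM.isContragredient N
  have h1 : ft (dualAtom hM s v N y) =ᵐ[volume] _ :=
    ((hv.distComp hcon y).smul (c : ℂ)).ft_ae_eq
  have h2 := integral_comp_equiv AT.symm (fun η => chr y η * dilatedProduct hM f v N η)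
  rw [hcon.absDet, inv_inv, Complex.real_smul] at h2
  have hApos : (absDet A : ℂ) ≠ 0 := by exact_mod_cast (absDet_pos A).ne'
  have h3 : ∫ η, chr y η * dilatedProduct hM f v N η = (((absDet A)⁻¹ : ℝ) : ℂ) *
      ∫ x, chr y (AT.symm x) * dilatedProduct hM f v N (AT.symm x) := by
    rw [h2]; push_cast; field_simp
  rw [pairing_eq, h3, ← mul_assoc, ← integral_const_mul]
  refine integral_congr_ae ?_
  filter_upwards [h1] with η hη
  rw [hη, dilatedProduct, ← hAT, AT.apply_symm_apply, chr_neg]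
  simp only [map_mul, Complex.conj_ofReal, Complex.conj_conj]
  ring

/-- The weights in `η` and in `2πη` are comparable; the absolute value in the constant `(4π²)^{|r|}`
serves both signs of `r`. -/
theorem le_weight_of_memSobolev {r : ℝ} {f : 𝓢'(Euc d, ℂ)} (hf : MemSobolev r 2 f) :
    Integrable (fun η => ‖ft f η‖ ^ 2 * (1 + ‖(2 * Real.pi) • η‖ ^ 2) ^ r) := by
  obtain ⟨h1, h2⟩ := exists_isFt_of_memSobolev hf
  have h3 := (memLp_two_iff_integrable_sq_norm h2.1).1 h2
  simp only [sq_weight] at h3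
  have hcont : Continuous fun η : Euc d => (1 + ‖(2 * Real.pi) • η‖ ^ 2) ^ r :=
    Continuous.rpow_const (by fun_prop) fun x => Or.inl (one_add_sq_pos _).ne'
  refine (h3.const_mul ((4 * Real.pi ^ 2) ^ |r|)).mono
    ((h1.1.aestronglyMeasurable.norm.pow 2).mul hcont.aestronglyMeasurable)
    (Filter.Eventually.of_forall fun η => ?_)
  have hp : (1 : ℝ) ≤ 4 * Real.pi ^ 2 := by nlinarith [Real.pi_gt_three]
  have hw := one_add_sq_pos η
  have hw' := one_add_sq_pos ((2 * Real.pi) • η)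
  rw [Real.norm_of_nonneg (by positivity), Real.norm_of_nonneg (by positivity), mul_left_comm]
  refine mul_le_mul_of_nonneg_left ?_ (by positivity)
  have hsq : ‖(2 * Real.pi) • η‖ ^ 2 = 4 * Real.pi ^ 2 * ‖η‖ ^ 2 := by
    rw [norm_smul, mul_pow, Real.norm_of_nonneg (by positivity)]; ring
  rcases le_total 0 r with hr | hr
  · rw [abs_of_nonneg hr, ← Real.mul_rpow (by positivity) hw.le]
    refine Real.rpow_le_rpow hw'.le ?_ hr
    rw [hsq]; nlinarith
  · have h5 : (1 + ‖(2 * Real.pi) • η‖ ^ 2) ^ r ≤ (1 + ‖η‖ ^ 2) ^ r := by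
      refine Real.rpow_le_rpow_of_nonpos hw ?_ hr
      rw [hsq]; nlinarith [sq_nonneg ‖η‖]
    refine h5.trans (le_mul_of_one_le_left (by positivity) (Real.one_le_rpow hp (abs_nonneg _)))

/-- Pointwise comparison of the weights before and after dilation. -/
theorem weight_le {K q t s r : ℝ} (hK : 1 ≤ K) (hq : 0 ≤ q) (hq1 : q ≤ 1) (ht : 0 ≤ t) (hs : 0 ≤ s)
    (hr : s + t ≤ r) {η ξ : Euc d} (h : ‖η‖ ≤ K * q * ‖ξ‖) :
    (‖η‖ ^ t) ^ 2 * (1 + ‖η‖ ^ 2) ^ s ≤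
      (K ^ 2) ^ (s + t) * (q ^ t) ^ 2 * (1 + ‖(2 * Real.pi) • ξ‖ ^ 2) ^ r := by
  have hK0 : 0 ≤ K := by linarith
  have hsq : ‖(2 * Real.pi) • ξ‖ ^ 2 = 4 * Real.pi ^ 2 * ‖ξ‖ ^ 2 := by
    rw [norm_smul, mul_pow, Real.norm_of_nonneg (by positivity)]; ring
  have hp : (1 : ℝ) ≤ 4 * Real.pi ^ 2 := by nlinarith [Real.pi_gt_three]
  set W := 1 + ‖(2 * Real.pi) • ξ‖ ^ 2 with hW
  have hW1 : 1 ≤ W := by rw [hW]; nlinarith [sq_nonneg ‖(2 * Real.pi) • ξ‖]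
  have hξ : ‖ξ‖ ^ 2 ≤ W := by rw [hW, hsq]; nlinarith [sq_nonneg ‖ξ‖]
  have h1 : ‖η‖ ^ 2 ≤ K ^ 2 * q ^ 2 * ‖ξ‖ ^ 2 := by
    rw [← mul_pow, ← mul_pow]; gcongr
  have h2 : (‖η‖ ^ t) ^ 2 ≤ (K ^ 2) ^ t * (q ^ t) ^ 2 * W ^ t := by
    have e : ∀ x : ℝ, 0 ≤ x → (x ^ t) ^ 2 = (x ^ 2) ^ t := fun x hx => by
      rw [← Real.rpow_natCast, ← Real.rpow_natCast, ← Real.rpow_mul hx, ← Real.rpow_mul hx, mul_comm]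
    rw [e _ (norm_nonneg _), e _ hq, ← Real.mul_rpow (by positivity) (by positivity),
      ← Real.mul_rpow (by positivity) (by positivity)]
    refine Real.rpow_le_rpow (by positivity) (h1.trans ?_) ht
    gcongr
  have h3 : (1 + ‖η‖ ^ 2) ^ s ≤ (K ^ 2) ^ s * W ^ s := by
    rw [← Real.mul_rpow (by positivity) (by positivity)]
    refine Real.rpow_le_rpow (by positivity) ?_ hs
    have hK2 : 1 ≤ K ^ 2 := by nlinarith
    have hq2 : q ^ 2 ≤ 1 := by nlinarith
    have h4 : ‖η‖ ^ 2 ≤ K ^ 2 * ‖ξ‖ ^ 2 := h1.trans (by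
      refine mul_le_mul_of_nonneg_right ?_ (by positivity)
      exact mul_le_of_le_one_right (by positivity) hq2)
    have h5 : K ^ 2 * W = K ^ 2 + K ^ 2 * (4 * Real.pi ^ 2 * ‖ξ‖ ^ 2) := by rw [hW, hsq]; ring
    rw [h5]
    have : K ^ 2 * ‖ξ‖ ^ 2 ≤ K ^ 2 * (4 * Real.pi ^ 2 * ‖ξ‖ ^ 2) := by
      refine mul_le_mul_of_nonneg_left ?_ (by positivity)
      nlinarith [sq_nonneg ‖ξ‖]
    linarith
  calc _ ≤ ((K ^ 2) ^ t * (q ^ t) ^ 2 * W ^ t) * ((K ^ 2) ^ s * W ^ s) := by gcongr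
    _ = (K ^ 2) ^ (s + t) * (q ^ t) ^ 2 * W ^ (s + t) := by
      rw [Real.rpow_add (by positivity), Real.rpow_add (by positivity)]; ring
    _ ≤ _ := by
      gcongr

/-- Weighted square integrability of the sampled function, after multiplication by a function that
is small near the origin. -/
theorem dilatedProduct_weight (hM : IsIsotropicDilation M) (hd : 1 ≤ d) {K : ℝ} (hK : 1 ≤ K)
    (hKle : ∀ (N : ℕ) (x : Euc d), ‖x‖ ≤ K * (scale M ^ N)⁻¹ * ‖(hM.transposeEquiv ^ N) x‖)
    {s t r : ℝ} (hs : 0 ≤ s) (ht : 0 ≤ t) (hr : s + t ≤ r) {f v : 𝓢'(Euc d, ℂ)}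
    (hf : MemSobolev r 2 f) (hv : IsFt v (ft v)) {V : ℝ} (hV : ∀ᵐ η, ‖ft v η‖ ≤ V) (N : ℕ)
    {E : Euc d → ℂ} (hE : Continuous E) {c : ℝ} (hEc : ∀ η, ‖E η‖ ≤ c * ‖η‖ ^ t) :
    MemLp (fun η => ((1 + ‖η‖ ^ 2) ^ (s / 2) : ℝ) * (E η * dilatedProduct hM f v N η)) 2 volume ∧
      (∫ η, ‖E η * dilatedProduct hM f v N η‖ ^ 2 * (1 + ‖η‖ ^ 2) ^ s) ≤
        V ^ 2 * (K ^ 2) ^ (s + t) * c ^ 2 * (((scale M ^ N)⁻¹) ^ t) ^ 2 *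
          (scale M ^ (N * d))⁻¹ * sobolevNorm r f ^ 2 := by
  have hscale := hM.one_lt_scale hd
  set q : ℝ := (scale M ^ N)⁻¹ with hq
  set AT := hM.transposeEquiv ^ N with hAT
  have hq0 : 0 ≤ q := by positivity
  have hq1 : q ≤ 1 := inv_le_one_of_one_le₀ (one_le_pow₀ hscale.le)
  have hfint := le_weight_of_memSobolev hf
  set Φ : Euc d → ℝ := fun ξ => ‖ft f ξ‖ ^ 2 * (1 + ‖(2 * Real.pi) • ξ‖ ^ 2) ^ r with hΦ
  have hΦ' : Integrable (fun η => Φ (AT η)) := (integrable_comp_equiv AT Φ).2 hfint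
  have hfm : AEStronglyMeasurable (fun η => ft f (AT η)) :=
    (exists_isFt_of_memSobolev hf).1.1.aestronglyMeasurable.comp_quasiMeasurePreserving
      (quasiMeasurePreserving_equiv AT)
  have hm : AEStronglyMeasurable (fun η =>
      (((1 + ‖η‖ ^ 2) ^ (s / 2) : ℝ) : ℂ) * (E η * dilatedProduct hM f v N η)) :=
    (Complex.continuous_ofReal.comp (continuous_weight (s / 2))).aestronglyMeasurable.mul
      (hE.aestronglyMeasurable.mul
        (hfm.mul (Complex.continuous_conj.comp_aestronglyMeasurable hv.1.aestronglyMeasurable)))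
  set C := V ^ 2 * (K ^ 2) ^ (s + t) * c ^ 2 * (q ^ t) ^ 2 with hC
  -- The factor `‖η‖^t` from `E` and the weight of order `s` are traded together for the weight of
  -- order `r` at `(Mᵀ)ᴺη`, gaining `q^{2t}` with `q = m^{-N}`.
  have hle : ∀ᵐ η, ‖E η * dilatedProduct hM f v N η‖ ^ 2 * (1 + ‖η‖ ^ 2) ^ s ≤ C * Φ (AT η) := by
    filter_upwards [hV] with η hη
    have h1 : ‖E η * dilatedProduct hM f v N η‖ ^ 2 ≤
        (c * ‖η‖ ^ t) ^ 2 * (‖ft f (AT η)‖ ^ 2 * V ^ 2) := by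
      rw [dilatedProduct, norm_mul, norm_mul, RCLike.norm_conj, mul_pow, mul_pow _ ‖ft v η‖]
      have := hEc η
      gcongr
    have h2 := weight_le (r := r) hK hq0 hq1 ht hs hr (hKle N η)
    have hw := one_add_sq_pos η
    calc _ ≤ (c * ‖η‖ ^ t) ^ 2 * (‖ft f (AT η)‖ ^ 2 * V ^ 2) * (1 + ‖η‖ ^ 2) ^ s := by gcongr
      _ = c ^ 2 * (‖ft f (AT η)‖ ^ 2 * V ^ 2) * ((‖η‖ ^ t) ^ 2 * (1 + ‖η‖ ^ 2) ^ s) := by ring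
      _ ≤ c ^ 2 * (‖ft f (AT η)‖ ^ 2 * V ^ 2) *
          ((K ^ 2) ^ (s + t) * (q ^ t) ^ 2 * (1 + ‖(2 * Real.pi) • AT η‖ ^ 2) ^ r) := by gcongr
      _ = C * Φ (AT η) := by rw [hC, hΦ]; ring
  have hint : Integrable
      (fun η => ‖E η * dilatedProduct hM f v N η‖ ^ 2 * (1 + ‖η‖ ^ 2) ^ s) := by
    refine (hΦ'.const_mul C).mono ?_ ?_
    · simp_rw [← sq_weight s (fun η => E η * dilatedProduct hM f v N η)]
      exact hm.norm.pow 2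
    · filter_upwards [hle] with η hη
      have hw := one_add_sq_pos η
      rw [Real.norm_of_nonneg (by positivity)]
      exact hη.trans (le_abs_self _)
  refine ⟨?_, ?_⟩
  · rw [memLp_two_iff_integrable_sq_norm hm]
    simpa only [sq_weight s (fun η => E η * dilatedProduct hM f v N η)] using hint
  · refine (integral_mono_ae hint (hΦ'.const_mul C) hle).trans_eq ?_
    rw [integral_const_mul, integral_comp_equiv AT Φ, sobolevNorm_sq, smul_eq_mul]
    have hdet : absDet AT = scale M ^ (N * d) := by
      have h := (hM.isContragredient N).absDet
      rw [absDet_symm, inv_inj, absDet_pow hM.equiv, hM.absDet_equiv, ← scale_pow M hd] at h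
      rw [hAT, h, ← pow_mul, mul_comm]
    rw [hdet]
    ring

/-! ### Synthesis with dilated and shifted atoms -/

/-- The essential supremum of the bracket of `u` is at most `B`. -/
def BracketLe (u : 𝓢'(Euc d, ℂ)) (B : ℝ) : Prop :=
  0 ≤ B ∧ ∀ᵐ x, ∑' k : Fin d → ℤ, ‖ft u (x + lat k)‖ₑ ^ 2 ≤ ENNReal.ofReal B

/-- The transform of an atom is a lattice character times the transform of `u`, both taken at
`(Mᵀ)^{-N}ξ`. Synthesis is therefore multiplication of a periodic function by `ft u`, a dilation,
and an inverse Fourier transform. The powers of `m` in the norm are `N(d/2 - s) - Nd + Nd/2 = -Ns`.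
-/
theorem exists_atomSynthesis (hM : IsIsotropicDilation M) (hd : 1 ≤ d) (s : ℝ) (u : L2 d) {B : ℝ}
    (hB : BracketLe (u : 𝓢'(Euc d, ℂ)) B) (N : ℕ) :
    ∃ S : CubeL2 d →L[ℂ] L2 d, (∀ k, S (cubeExp k) = primalAtom hM s u N k) ∧
      (∀ H, (𝓕 (S H) : L2 d) =ᵐ[volume] fun ξ =>
        ((scale M ^ ((N : ℝ) * ((d : ℝ) / 2 - s)) * (scale M ^ (N * d))⁻¹ : ℝ) : ℂ) *
          (H (cubePart ((hM.transposeEquiv ^ N).symm ξ)) *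
            ft (u : 𝓢'(Euc d, ℂ)) ((hM.transposeEquiv ^ N).symm ξ))) ∧
      ∀ H, ‖S H‖ ≤ scale M ^ (-(N : ℝ) * s) * Real.sqrt B * ‖H‖ := by
  have hscale := hM.one_lt_scale hd
  have hscale0 : 0 < scale M := by linarith
  set A := hM.equiv ^ N with hA
  set AT := hM.transposeEquiv ^ N with hAT
  have hcon : IsContragredient A AT.symm := hM.isContragredient N
  have hdet : absDet A = scale M ^ (N * d) := by
    rw [hA, absDet_pow, hM.absDet_equiv, ← scale_pow M hd, ← pow_mul, mul_comm]
  obtain ⟨T, hT, hTn⟩ := exists_synthesis (isFt_L2 u).isFt_ft.1.aestronglyMeasurable hB.1 hB.2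
  obtain ⟨D, hD, hDn⟩ := exists_dilation AT.symm
  set c : ℝ := scale M ^ ((N : ℝ) * ((d : ℝ) / 2 - s)) with hc
  have hc0 : 0 < c := Real.rpow_pos_of_pos hscale0 _
  set S : CubeL2 d →L[ℂ] L2 d := (((c * (scale M ^ (N * d))⁻¹ : ℝ)) : ℂ) •
    ((Lp.fourierTransformₗᵢ (Euc d) ℂ).symm : L2 d →L[ℂ] L2 d) ∘L D ∘L T with hS
  have hSapp : ∀ H, S H = (((c * (scale M ^ (N * d))⁻¹ : ℝ)) : ℂ) •
    (Lp.fourierTransformₗᵢ (Euc d) ℂ).symm (D (T H)) := fun H => rfl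
  have hSF : ∀ H, (𝓕 (S H) : L2 d) = (((c * (scale M ^ (N * d))⁻¹ : ℝ)) : ℂ) • D (T H) := by
    intro H
    change Lp.fourierTransformₗᵢ (Euc d) ℂ (S H) = _
    rw [hSapp, map_smul, LinearIsometryEquiv.apply_symm_apply]
  have hSF' : ∀ H, (𝓕 (S H) : L2 d) =ᵐ[volume] fun ξ =>
        ((c * (scale M ^ (N * d))⁻¹ : ℝ) : ℂ) *
          (H (cubePart (AT.symm ξ)) * ft (u : 𝓢'(Euc d, ℂ)) (AT.symm ξ)) := by
    intro H
    rw [hSF]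
    filter_upwards [Lp.coeFn_smul (((c * (scale M ^ (N * d))⁻¹ : ℝ)) : ℂ) (D (T H)), hD (T H),
      (quasiMeasurePreserving_equiv AT.symm).ae (hT H)] with ξ h1 h2 h3
    rw [h1, Pi.smul_apply, h2, h3, smul_eq_mul]
  refine ⟨S, fun k => ?_, hSF', fun H => ?_⟩
  · apply (Lp.fourierTransformₗᵢ (Euc d) ℂ).injective
    change (𝓕 (S (cubeExp k)) : L2 d) = 𝓕 (primalAtom hM s u N k)
    refine Lp.ext ?_
    have h1 : (𝓕 (primalAtom hM s u N k) : L2 d) = (c : ℂ) • 𝓕 (funComp A (lat k) u) :=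
      map_smul (Lp.fourierTransformₗᵢ (Euc d) ℂ) _ _
    have h2 : ft (funComp A (lat k) u : 𝓢'(Euc d, ℂ)) =ᵐ[volume] fun η =>
        ((absDet A)⁻¹ : ℝ) * (chr (-lat k) (AT.symm η) *
          ft (u : 𝓢'(Euc d, ℂ)) (AT.symm η)) := by
      rw [funComp_toTemperedDistribution]
      exact ((isFt_L2 u).isFt_ft.distComp hcon (lat k)).ft_ae_eq
    rw [h1]
    filter_upwards [hSF' (cubeExp k), Lp.coeFn_smul (c : ℂ) (𝓕 (funComp A (lat k) u) : L2 d),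
      h2, ft_L2 (funComp A (lat k) u), (quasiMeasurePreserving_equiv AT.symm).ae
        (ae_cubePart (memLp_chr (-lat k)).coeFn_toLp)] with ξ h3 h4 h5 h6 h7
    rw [h3, h4, Pi.smul_apply, ← h6, h5, cubeExp, h7, smul_eq_mul, hdet]
    have h8 : chr (-lat k) (cubePart (AT.symm ξ)) = chr (-lat k) (AT.symm ξ) := by
      conv_rhs => rw [← cubePart_add_cubeIndex (AT.symm ξ), chr_add_right, ← lat_neg, chr_lat_lat,
        mul_one]
      rw [lat_neg]
    rw [h8]
    push_cast
    ring
  · rw [hSapp, norm_smul, LinearIsometryEquiv.norm_map, hDn, hcon.absDet, inv_inv, hdet,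
      Complex.norm_real, Real.norm_of_nonneg (by positivity)]
    have h1 : c * (scale M ^ (N * d))⁻¹ * Real.sqrt (scale M ^ (N * d)) =
        scale M ^ (-(N : ℝ) * s) := by
      rw [Real.sqrt_eq_rpow, ← Real.rpow_natCast, ← Real.rpow_mul hscale0.le,
        ← Real.rpow_neg hscale0.le, hc, ← Real.rpow_add hscale0, ← Real.rpow_add hscale0]
      congr 1
      push_cast
      ring
    calc c * (scale M ^ (N * d))⁻¹ * (Real.sqrt (scale M ^ (N * d)) * ‖T H‖)
        = (c * (scale M ^ (N * d))⁻¹ * Real.sqrt (scale M ^ (N * d))) * ‖T H‖ := by ring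
      _ ≤ scale M ^ (-(N : ℝ) * s) * (Real.sqrt B * ‖H‖) := by
        rw [h1]; gcongr; exact hTn H
      _ = _ := by ring

/-- A square summable sequence is the sequence of Fourier coefficients of a function on the cube. -/
theorem exists_cubeL2_of_summable {c : (Fin d → ℤ) → ℂ} (hc : Summable fun k => ‖c k‖ ^ 2) :
    ∃ H : CubeL2 d, HasSum (fun k => c k • cubeExp k) H ∧ ‖H‖ ^ 2 = ∑' k, ‖c k‖ ^ 2 := by
  have hmem : Memℓp c 2 := memℓp_gen (by simpa using hc)
  set x : lp (fun _ : Fin d → ℤ => ℂ) 2 := ⟨c, hmem⟩ with hx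
  refine ⟨(cubeBasis d).repr.symm x, ?_, ?_⟩
  · have := (cubeBasis d).hasSum_repr_symm x
    rwa [coe_cubeBasis] at this
  · rw [LinearIsometryEquiv.norm_map]
    have := lp.norm_rpow_eq_tsum (p := 2) (by norm_num) x
    simpa using this

/-! ### Shift-perturbed sampling -/

/-- The inverse Fourier transform of `dilatedProduct` at `y`. -/
def sampleValue (hM : IsIsotropicDilation M) (f v : 𝓢'(Euc d, ℂ)) (N : ℕ) (y : Euc d) : ℂ :=
  ∫ η, chr y η * dilatedProduct hM f v N η

theorem shiftTerm_eq (hM : IsIsotropicDilation M) (s : ℝ) (u : L2 d) {v : 𝓢'(Euc d, ℂ)}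
    (hv : IsFt v (ft v)) (N : ℕ) (ε : (Fin d → ℤ) → Euc d) (f : L2 d) (k : Fin d → ℤ) :
    shiftTerm hM s u v N ε f k =
      (((scale M ^ ((N : ℝ) * ((d : ℝ) / 2 + s)) : ℝ) : ℂ) *
        sampleValue hM (f : 𝓢'(Euc d, ℂ)) v N (lat k + ε k)) • primalAtom hM s u N k := by
  rw [shiftTerm, pairing_dualAtom hM s _ hv, sampleValue]

theorem min_two_le {t β : ℝ} (ht : 0 ≤ t) (hβ : 0 ≤ β) (hβ1 : β ≤ 1) : min 2 t ≤ 2 * t ^ β := by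
  rcases le_total t 1 with h | h
  · have h1 : t ≤ t ^ β := by
      conv_lhs => rw [← Real.rpow_one t]
      exact Real.rpow_le_rpow_of_exponent_ge_of_imp ht h hβ1 (fun _ h1 => absurd h1 one_ne_zero)
    have := Real.rpow_nonneg ht β
    exact (min_le_right _ _).trans (by linarith)
  · have := Real.one_le_rpow h hβ
    exact (min_le_left _ _).trans (by linarith)

/-- Interpolation between the bounds `2` and `|2π y·η|`. The constant arises from `2(2π)^β ≤ 4π`. -/
theorem norm_chr_sub_one_le {β : ℝ} (hβ : 0 ≤ β) (hβ1 : β ≤ 1) (y η : Euc d) :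
    ‖chr y η - 1‖ ≤ 4 * Real.pi * ‖y‖ ^ β * ‖η‖ ^ β := by
  have hpi := Real.pi_gt_three
  have h1 : ‖chr y η - 1‖ ≤ min 2 (2 * Real.pi * ‖y‖ * ‖η‖) := by
    refine le_min ?_ ?_
    · refine (norm_sub_le _ _).trans ?_
      rw [norm_chr, norm_one]; norm_num
    · rw [chr, mul_comm]
      refine (Real.norm_exp_I_mul_ofReal_sub_one_le).trans ?_
      rw [norm_mul, Real.norm_of_nonneg (by positivity)]
      refine (mul_le_mul_of_nonneg_left (norm_inner_le_norm (𝕜 := ℝ) y η)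
        (by positivity)).trans_eq (by ring)
  refine h1.trans ((min_two_le (by positivity) hβ hβ1).trans ?_)
  rw [Real.mul_rpow (by positivity) (by positivity), Real.mul_rpow (by positivity) (by positivity)]
  have h2 : (2 * Real.pi) ^ β ≤ 2 * Real.pi := by
    conv_rhs => rw [← Real.rpow_one (2 * Real.pi)]
    exact Real.rpow_le_rpow_of_exponent_le (by linarith) hβ1
  calc 2 * ((2 * Real.pi) ^ β * ‖y‖ ^ β * ‖η‖ ^ β) ≤ 2 * (2 * Real.pi * ‖y‖ ^ β * ‖η‖ ^ β) := by
        gcongr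
    _ = _ := by ring

/-- Moments of the Fourier transform of a Sobolev function are integrable. -/
theorem exists_moment_le {r β : ℝ} (hβ : 0 ≤ β) (hr : β < r - (d : ℝ) / 2) : ∃ C : ℝ, 0 ≤ C ∧
    ∀ f : 𝓢'(Euc d, ℂ), MemSobolev r 2 f → Integrable (fun ξ => ‖ξ‖ ^ β * ‖ft f ξ‖) ∧
      ∫ ξ, ‖ξ‖ ^ β * ‖ft f ξ‖ ≤ C * sobolevNorm r f := by
  have hw : ∀ ξ : Euc d, 0 < 1 + ‖(2 * Real.pi) • ξ‖ ^ 2 := fun ξ => one_add_sq_pos _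
  have hcw : ∀ t : ℝ, Continuous fun ξ : Euc d => (1 + ‖(2 * Real.pi) • ξ‖ ^ 2) ^ t := fun t =>
    Continuous.rpow_const (by fun_prop) fun x => Or.inl (hw _).ne'
  have hcb : Continuous fun ξ : Euc d => ‖ξ‖ ^ β :=
    continuous_norm.rpow_const fun _ => Or.inr hβ
  -- Cauchy–Schwarz splitting: `a` carries the moment and the inverse Sobolev weight, and is square
  -- integrable because `2(r - β) > d`. The other factor has `L²` norm equal to the Sobolev norm.
  set a : Euc d → ℝ := fun ξ => ‖ξ‖ ^ β * (1 + ‖(2 * Real.pi) • ξ‖ ^ 2) ^ (-r / 2) with ha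
  have ha0 : ∀ ξ, 0 ≤ a ξ := fun ξ => by have := hw ξ; positivity
  have hr0 : 0 ≤ r := by
    have : (0 : ℝ) ≤ (d : ℝ) / 2 := by positivity
    linarith
  have haint : Integrable fun ξ => a ξ ^ 2 := by
    have h1 := integrable_rpow_neg_one_add_norm_sq (E := Euc d) (μ := volume) (r := 2 * (r - β))
      (by simp; linarith)
    refine h1.mono ((hcb.mul (hcw _)).pow 2).aestronglyMeasurable
      (Filter.Eventually.of_forall fun ξ => ?_)
    have hx := one_add_sq_pos ξ
    rw [Real.norm_of_nonneg (by positivity), Real.norm_of_nonneg (by positivity), ha]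
    have h2 : (1 + ‖(2 * Real.pi) • ξ‖ ^ 2) ^ (-r) ≤ (1 + ‖ξ‖ ^ 2) ^ (-r) := by
      refine Real.rpow_le_rpow_of_nonpos hx ?_ (by linarith)
      rw [norm_smul, mul_pow, Real.norm_of_nonneg (by positivity)]
      nlinarith [Real.pi_gt_three, sq_nonneg ‖ξ‖, mul_nonneg (sq_nonneg ‖ξ‖) Real.pi_pos.le]
    have h3 : ‖ξ‖ ^ (2 * β) ≤ (1 + ‖ξ‖ ^ 2) ^ β := by
      rw [Real.rpow_mul (norm_nonneg _)]
      refine Real.rpow_le_rpow (by positivity) ?_ hβ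
      norm_num
    have hwx := hw ξ
    calc (‖ξ‖ ^ β * (1 + ‖(2 * Real.pi) • ξ‖ ^ 2) ^ (-r / 2)) ^ 2
        = ‖ξ‖ ^ (2 * β) * (1 + ‖(2 * Real.pi) • ξ‖ ^ 2) ^ (-r) := by
          rw [mul_pow, ← Real.rpow_mul_natCast (norm_nonneg _), ← Real.rpow_mul_natCast hwx.le]
          congr 2 <;> push_cast <;> ring
      _ ≤ (1 + ‖ξ‖ ^ 2) ^ β * (1 + ‖ξ‖ ^ 2) ^ (-r) := by gcongr
      _ = _ := by rw [← Real.rpow_add hx]; congr 1; ring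
  refine ⟨Real.sqrt (∫ ξ, a ξ ^ 2), Real.sqrt_nonneg _, fun f hf => ?_⟩
  have hfint := le_weight_of_memSobolev hf
  have hfm : AEStronglyMeasurable (ft f) := (exists_isFt_of_memSobolev hf).1.1.aestronglyMeasurable
  set b : Euc d → ℝ := fun ξ => ‖ft f ξ‖ * (1 + ‖(2 * Real.pi) • ξ‖ ^ 2) ^ (r / 2) with hb
  have hb0 : ∀ ξ, 0 ≤ b ξ := fun ξ => by have := hw ξ; positivity
  have hbsq : ∀ ξ, b ξ ^ 2 = ‖ft f ξ‖ ^ 2 * (1 + ‖(2 * Real.pi) • ξ‖ ^ 2) ^ r := fun ξ => by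
    rw [hb, mul_pow, ← Real.rpow_mul_natCast (hw ξ).le]
    congr 2; push_cast; ring
  have hab : ∀ ξ, a ξ * b ξ = ‖ξ‖ ^ β * ‖ft f ξ‖ := fun ξ => by
    rw [ha, hb]
    have : (1 + ‖(2 * Real.pi) • ξ‖ ^ 2) ^ (-r / 2) * (1 + ‖(2 * Real.pi) • ξ‖ ^ 2) ^ (r / 2) = 1 := by
      rw [← Real.rpow_add (hw ξ)]; simp [neg_div]
    linear_combination (‖ξ‖ ^ β * ‖ft f ξ‖) * this
  have haL : MemLp a 2 volume := (memLp_two_iff_integrable_sq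
    (hcb.mul (hcw _)).aestronglyMeasurable).2 haint
  have hbm : AEStronglyMeasurable b := hfm.norm.mul (hcw _).aestronglyMeasurable
  have hbL : MemLp b 2 volume :=
    (memLp_two_iff_integrable_sq hbm).2 (by simpa only [hbsq] using hfint)
  refine ⟨(haL.integrable_mul hbL).congr (Filter.Eventually.of_forall hab), ?_⟩
  have h := integral_mul_le_Lp_mul_Lq_of_nonneg (μ := (volume : Measure (Euc d)))
    Real.HolderConjugate.two_two (Filter.Eventually.of_forall ha0) (Filter.Eventually.of_forall hb0)
    (by simpa using haL) (by simpa using hbL)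
  simp only [hab, Real.rpow_two, hbsq, ← Real.sqrt_eq_rpow] at h
  rw [← sobolevNorm_sq, Real.sqrt_sq (sobolevNorm_nonneg _ _)] at h
  exact h

theorem integrable_dilatedProduct (hM : IsIsotropicDilation M) {r : ℝ} (hr : (d : ℝ) / 2 < r)
    {f v : 𝓢'(Euc d, ℂ)} (hf : MemSobolev r 2 f) (hv : IsFt v (ft v)) {V : ℝ}
    (hV : ∀ᵐ η, ‖ft v η‖ ≤ V) (N : ℕ) : Integrable (dilatedProduct hM f v N) := by
  obtain ⟨C, _, h⟩ := exists_moment_le (d := d) (r := r) le_rfl (by linarith)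
  have h1 := (h f hf).1
  simp only [Real.rpow_zero, one_mul] at h1
  have h2 : Integrable (ft f) := (integrable_norm_iff
    (exists_isFt_of_memSobolev hf).1.1.aestronglyMeasurable).1 h1
  have h3 : Integrable fun η => ft f ((hM.transposeEquiv ^ N) η) :=
    (integrable_comp_equiv (hM.transposeEquiv ^ N) (ft f)).2 h2
  refine h3.mul_bdd (c := V)
    (Complex.continuous_conj.comp_aestronglyMeasurable hv.1.aestronglyMeasurable) ?_
  filter_upwards [hV] with η hη
  rwa [RCLike.norm_conj]

/-- The variation of the sampled function under a shift of the sampling point. -/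
theorem exists_sampleValue_sub_le (hM : IsIsotropicDilation M) (hd : 1 ≤ d) {r β : ℝ} (hβ : 0 ≤ β)
    (hβ1 : β ≤ 1) (hr : β < r - (d : ℝ) / 2) {v : 𝓢'(Euc d, ℂ)} (hv : IsFt v (ft v)) {V : ℝ}
    (hV0 : 0 ≤ V) (hV : ∀ᵐ η, ‖ft v η‖ ≤ V) : ∃ C : ℝ, 0 ≤ C ∧
      ∀ (f : 𝓢'(Euc d, ℂ)), MemSobolev r 2 f → ∀ (N : ℕ) (y x : Euc d),
        ‖sampleValue hM f v N (y + x) - sampleValue hM f v N y‖ ≤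
          C * sobolevNorm r f * ((scale M ^ N)⁻¹ ^ β * (scale M ^ (N * d))⁻¹) * ‖x‖ ^ β := by
  obtain ⟨K, hK, hKle⟩ := hM.exists_norm_symm_le hd
  obtain ⟨C, hC, hCle⟩ := exists_moment_le (d := d) hβ hr
  have hscale := hM.one_lt_scale hd
  refine ⟨4 * Real.pi * V * K ^ β * C, by positivity, fun f hf N y x => ?_⟩
  set AT := hM.transposeEquiv ^ N with hAT
  set q := (scale M ^ N)⁻¹ with hq
  have hq0 : 0 ≤ q := by positivity
  have hGi := integrable_dilatedProduct hM (by linarith) hf hv hV N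
  have hi : ∀ z : Euc d, Integrable fun η => chr z η * dilatedProduct hM f v N η := fun z =>
    hGi.bdd_mul (c := 1) (continuous_chr _).aestronglyMeasurable
      (Filter.Eventually.of_forall fun η => (norm_chr z η).le)
  set Φ : Euc d → ℝ := fun ξ => ‖ξ‖ ^ β * ‖ft f ξ‖ with hΦ
  have hΦi : Integrable fun η => Φ (AT η) := (integrable_comp_equiv AT Φ).2 (hCle f hf).1
  have hdet : absDet AT = scale M ^ (N * d) := by
    have h := (hM.isContragredient N).absDet
    rw [absDet_symm, inv_inj, absDet_pow hM.equiv, hM.absDet_equiv, ← scale_pow M hd] at h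
    rw [hAT, h, ← pow_mul, mul_comm]
  rw [sampleValue, sampleValue, ← integral_sub (hi _) (hi _)]
  refine (norm_integral_le_integral_norm _).trans ?_
  -- The unimodular character at `y` factors out, so the bound is uniform in the base point. What
  -- remains is the `β`-moment of `f̂` at `(Mᵀ)ᴺη`.
  have hle : ∀ᵐ η, ‖chr (y + x) η * dilatedProduct hM f v N η -
      chr y η * dilatedProduct hM f v N η‖ ≤
      (4 * Real.pi * ‖x‖ ^ β * V * (K * q) ^ β) * Φ (AT η) := by
    filter_upwards [hV] with η hη
    have h1 : chr (y + x) η * dilatedProduct hM f v N η - chr y η * dilatedProduct hM f v N η =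
        chr y η * ((chr x η - 1) * dilatedProduct hM f v N η) := by
      rw [chr_add]; ring
    rw [h1, norm_mul, norm_chr, one_mul, norm_mul, dilatedProduct, norm_mul, RCLike.norm_conj]
    have h2 := norm_chr_sub_one_le hβ hβ1 x η
    have h3 : ‖η‖ ^ β ≤ (K * q) ^ β * ‖AT η‖ ^ β := by
      rw [← Real.mul_rpow (by positivity) (by positivity)]
      exact Real.rpow_le_rpow (norm_nonneg _) (hKle N η) hβ
    calc ‖chr x η - 1‖ * (‖ft f (AT η)‖ * ‖ft v η‖)
        ≤ (4 * Real.pi * ‖x‖ ^ β * ((K * q) ^ β * ‖AT η‖ ^ β)) * (‖ft f (AT η)‖ * V) := by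
          gcongr
          exact h2.trans (by gcongr)
      _ = _ := by rw [hΦ]; ring
  refine (integral_mono_ae ((hi _).sub (hi _)).norm (hΦi.const_mul _) hle).trans ?_
  rw [integral_const_mul, integral_comp_equiv AT Φ, hdet, smul_eq_mul,
    Real.mul_rpow (by linarith) hq0]
  have := (hCle f hf).2
  calc 4 * Real.pi * ‖x‖ ^ β * V * (K ^ β * q ^ β) * ((scale M ^ (N * d))⁻¹ * ∫ ξ, Φ ξ)
      ≤ 4 * Real.pi * ‖x‖ ^ β * V * (K ^ β * q ^ β) *
        ((scale M ^ (N * d))⁻¹ * (C * sobolevNorm r f)) := by gcongr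
    _ = _ := by ring

/-! ### Sequence norms -/

/-- All but finitely many terms have norm at most one, where a larger exponent gives a smaller
power. -/
theorem summable_norm_rpow_of_le {α p : ℝ} (hα : 0 < α) (hp : α ≤ p) {x : (Fin d → ℤ) → Euc d}
    (hx : Summable fun k => ‖x k‖ ^ α) : Summable fun k => ‖x k‖ ^ p := by
  have h1 : ∀ᶠ k in Filter.cofinite, ‖x k‖ ^ α < 1 :=
    hx.tendsto_cofinite_zero.eventually (gt_mem_nhds one_pos)
  refine Summable.of_norm_bounded_eventually hx ?_
  filter_upwards [h1] with k hk
  have h2 : ‖x k‖ ≤ 1 := by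
    by_contra h
    exact absurd hk (not_lt.2 (Real.one_le_rpow (not_le.1 h).le hα.le))
  rw [Real.norm_of_nonneg (by positivity)]
  exact Real.rpow_le_rpow_of_exponent_ge_of_imp (norm_nonneg _) h2 hp (fun _ h => by linarith)

theorem maxNorm_nonneg (α : ℝ) (x : (Fin d → ℤ) → Euc d) : 0 ≤ maxNorm α x :=
  le_max_of_le_left (Real.rpow_nonneg (tsum_nonneg fun k => by positivity) _)

/-- For `α ≤ p ≤ 2` one has `t^p ≤ t^α + t²`, and each of the two resulting sums is at most the
square of the max norm. -/
theorem tsum_rpow_le_maxNorm {α p : ℝ} (hα : 0 < α) (hp : α ≤ p) (hp2 : p ≤ 2)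
    {x : (Fin d → ℤ) → Euc d} (hx : Summable fun k => ‖x k‖ ^ α) :
    ∑' k, ‖x k‖ ^ p ≤ 2 * maxNorm α x ^ 2 := by
  have hx2 := summable_norm_rpow_of_le hα (hp.trans hp2) hx
  have h2 : ∑' k, ‖x k‖ ^ (2 : ℝ) ≤ maxNorm α x ^ 2 := by
    have h0 : 0 ≤ ∑' k, ‖x k‖ ^ (2 : ℝ) := tsum_nonneg fun k => by positivity
    have h1 : ellNorm 2 x ^ 2 = ∑' k, ‖x k‖ ^ (2 : ℝ) := by
      rw [ellNorm, ← Real.rpow_mul_natCast h0]; norm_num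
    rw [← h1]
    exact pow_le_pow_left₀ (Real.rpow_nonneg h0 _) (le_max_left _ _) 2
  have h3 : ∑' k, ‖x k‖ ^ α ≤ maxNorm α x ^ 2 := by
    have h0 : 0 ≤ ∑' k, ‖x k‖ ^ α := tsum_nonneg fun k => by positivity
    have h1 : (ellNorm α x ^ (α / 2)) ^ 2 = ∑' k, ‖x k‖ ^ α := by
      rw [ellNorm, ← Real.rpow_mul h0, ← Real.rpow_mul_natCast h0]
      have : 1 / α * (α / 2) * ((2 : ℕ) : ℝ) = 1 := by push_cast; field_simp
      rw [this, Real.rpow_one]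
    rw [← h1]
    exact pow_le_pow_left₀ (Real.rpow_nonneg (Real.rpow_nonneg h0 _) _) (le_max_right _ _) 2
  have h4 : ∀ k, ‖x k‖ ^ p ≤ ‖x k‖ ^ α + ‖x k‖ ^ (2 : ℝ) := by
    intro k
    rcases le_total ‖x k‖ 1 with h | h
    · have := Real.rpow_le_rpow_of_exponent_ge_of_imp (norm_nonneg (x k)) h hp
        (fun _ h => by linarith)
      have h5 := Real.rpow_nonneg (norm_nonneg (x k)) 2
      linarith
    · have := Real.rpow_le_rpow_of_exponent_le h hp2
      have h5 := Real.rpow_nonneg (norm_nonneg (x k)) α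
      linarith
  calc ∑' k, ‖x k‖ ^ p ≤ ∑' k, (‖x k‖ ^ α + ‖x k‖ ^ (2 : ℝ)) :=
        (summable_norm_rpow_of_le hα hp hx).tsum_le_tsum h4 (hx.add hx2)
    _ = ∑' k, ‖x k‖ ^ α + ∑' k, ‖x k‖ ^ (2 : ℝ) := hx.tsum_add hx2
    _ ≤ _ := by linarith

/-! ### Convergence of the series and stability under shifts -/

theorem IsIsotropicDilation.scale_pos (hM : IsIsotropicDilation M) (hd : 1 ≤ d) : 0 < scale M :=
  one_pos.trans (hM.one_lt_scale hd)

theorem hasSum_cubeExp (H : CubeL2 d) :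
    HasSum (fun k => (cubeBasis d).repr H k • (cubeExp k : CubeL2 d)) H := by
  have := (cubeBasis d).hasSum_repr H
  rwa [coe_cubeBasis] at this

/-- The case `E = 1`, `t = 0` of `dilatedProduct_weight`. -/
theorem memLp_periodize_dilatedProduct (hM : IsIsotropicDilation M) (hd : 1 ≤ d) {s r : ℝ}
    (hs : (d : ℝ) / 2 < s) (hr : s ≤ r) {f v : 𝓢'(Euc d, ℂ)} (hf : MemSobolev r 2 f)
    (hv : IsFt v (ft v)) {V : ℝ} (hV : ∀ᵐ η, ‖ft v η‖ ≤ V) (N : ℕ) :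
    MemLp (periodize (dilatedProduct hM f v N)) 2 (cubeMeasure d) := by
  obtain ⟨K, hK, hKle⟩ := hM.exists_norm_symm_le hd
  obtain ⟨C, _, hC⟩ := exists_periodize_bound hs
  have hs0 : 0 ≤ s := le_trans (by positivity) hs.le
  have h1 := (dilatedProduct_weight hM hd hK hKle hs0 le_rfl (by simpa using hr) hf hv hV N
    (E := fun _ => 1) continuous_const (c := 1) (by simp)).1
  simp only [one_mul] at h1
  exact (hC _ h1).1

/-- Convergence of the unperturbed series, and the Fourier transform of its sum. -/
theorem shiftOp_zero (hM : IsIsotropicDilation M) (hd : 1 ≤ d) {s r : ℝ}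
    (hs : (d : ℝ) / 2 < s) (hr : s ≤ r) {f : L2 d} {v : 𝓢'(Euc d, ℂ)}
    (hf : MemSobolev r 2 (f : 𝓢'(Euc d, ℂ))) (hv : IsFt v (ft v)) {V : ℝ}
    (hV : ∀ᵐ η, ‖ft v η‖ ≤ V) {u : L2 d} {B : ℝ} (hB : BracketLe (u : 𝓢'(Euc d, ℂ)) B) (N : ℕ) :
    Summable (shiftTerm hM s u v N 0 f) ∧
      (𝓕 (shiftOp hM s u v N 0 f) : L2 d) =ᵐ[volume] fun ξ =>
        ft (u : 𝓢'(Euc d, ℂ)) ((hM.transposeEquiv ^ N).symm ξ) *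
          periodize (dilatedProduct hM (f : 𝓢'(Euc d, ℂ)) v N)
            ((hM.transposeEquiv ^ N).symm ξ) := by
  obtain ⟨S, hSE, hSF, -⟩ := exists_atomSynthesis hM hd s u hB N
  have hm := hM.scale_pos hd
  set AT := hM.transposeEquiv ^ N with hAT
  have hP := memLp_periodize_dilatedProduct hM hd hs hr hf hv hV N
  have hGi := integrable_dilatedProduct hM (hs.trans_le hr) hf hv hV N
  set κ : ℂ := ((scale M ^ ((N : ℝ) * ((d : ℝ) / 2 + s)) : ℝ) : ℂ) with hκ
  have hsum : HasSum (shiftTerm hM s u v N 0 f) (S (κ • hP.toLp _)) := by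
    have h1 := ((hasSum_cubeExp (hP.toLp _)).const_smul κ).mapL S
    refine h1.congr_fun fun k => ?_
    rw [shiftTerm_eq hM s u hv, map_smul, map_smul, hSE, smul_smul,
      cubeBasis_repr_periodize hGi, sampleValue, Pi.zero_apply, add_zero]
  refine ⟨hsum.summable, ?_⟩
  rw [shiftOp, hsum.tsum_eq]
  filter_upwards [hSF (κ • hP.toLp _), (quasiMeasurePreserving_equiv AT.symm).ae
    (ae_cubePart (Lp.coeFn_smul κ (hP.toLp _))), (quasiMeasurePreserving_equiv AT.symm).ae
    (ae_cubePart hP.coeFn_toLp)] with ξ h1 h2 h3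
  rw [h1, h2, Pi.smul_apply, h3, periodize_cubePart, smul_eq_mul]
  -- Analysis, synthesis and dilation normalisations cancel: `(d/2 + s) + (d/2 - s) - d = 0`.
  have hc : ((scale M ^ ((N : ℝ) * ((d : ℝ) / 2 - s)) * (scale M ^ (N * d))⁻¹ : ℝ) : ℂ) * κ = 1 := by
    rw [hκ, ← Complex.ofReal_mul, ← Real.rpow_natCast, ← Real.rpow_neg hm.le, ← Real.rpow_add hm,
      ← Real.rpow_add hm]
    have : (N : ℝ) * ((d : ℝ) / 2 - s) + -((N * d : ℕ) : ℝ) + (N : ℝ) * ((d : ℝ) / 2 + s) = 0 := by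
      push_cast; ring
    rw [this, Real.rpow_zero, Complex.ofReal_one]
  linear_combination (periodize (dilatedProduct hM (f : 𝓢'(Euc d, ℂ)) v N) (AT.symm ξ) *
    ft (u : 𝓢'(Euc d, ℂ)) (AT.symm ξ)) * hc

/-- Exponent count for the common shift, whose `L²` estimate contributes `m^{-Nd/2}`. -/
theorem scale_rpow_mul_eq {m : ℝ} (hm : 0 < m) (N d : ℕ) (s ζ : ℝ) :
    m ^ (-(N : ℝ) * s) * (m ^ ((N : ℝ) * ((d : ℝ) / 2 + s)) *
      ((m ^ N)⁻¹ ^ ζ * Real.sqrt (m ^ (N * d))⁻¹)) = m ^ (-(N : ℝ) * ζ) := by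
  rw [Real.sqrt_eq_rpow, ← Real.rpow_natCast, ← Real.rpow_natCast,
    ← Real.rpow_neg hm.le, ← Real.rpow_neg hm.le, ← Real.rpow_mul hm.le, ← Real.rpow_mul hm.le,
    ← Real.rpow_add hm, ← Real.rpow_add hm, ← Real.rpow_add hm]
  congr 1
  push_cast
  ring

/-- Exponent count for the individual shifts. Their `L¹` estimate contributes the full `m^{-Nd}`, so
the decay is `m^{-N(β+d/2)}` and a Hölder order `β ≥ ζ - d/2` suffices. -/
theorem scale_rpow_mul_le {m : ℝ} (hm : 1 < m) (N : ℕ) {d : ℕ} {s ζ β : ℝ} (h : ζ - d / 2 ≤ β) :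
    m ^ (-(N : ℝ) * s) * (m ^ ((N : ℝ) * ((d : ℝ) / 2 + s)) *
      ((m ^ N)⁻¹ ^ β * (m ^ (N * d))⁻¹)) ≤ m ^ (-(N : ℝ) * ζ) := by
  have hm0 : 0 < m := one_pos.trans hm
  rw [← Real.rpow_natCast, ← Real.rpow_natCast, ← Real.rpow_neg hm0.le, ← Real.rpow_neg hm0.le,
    ← Real.rpow_mul hm0.le, ← Real.rpow_add hm0, ← Real.rpow_add hm0, ← Real.rpow_add hm0]
  refine Real.rpow_le_rpow_of_exponent_le hm.le ?_
  have h1 := mul_le_mul_of_nonneg_left h (Nat.cast_nonneg (α := ℝ) N)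
  push_cast
  linarith

theorem zetaExp_pos {s r α : ℝ} (hd : 1 ≤ d) (hr : s < r) (hα : 0 < α)
    (hα' : α < min (2 * s - d) 2) : 0 < zetaExp d s r α := by
  have h1 := lt_min_iff.1 hα'
  have hd' : (1 : ℝ) ≤ d := by exact_mod_cast hd
  refine lt_min one_pos (lt_min (by linarith) ?_)
  have h3 : 0 < (4 * s + (α - 2) * d) / (2 * s - α + 2) :=
    div_pos (by nlinarith) (by linarith)
  linarith

/-- Convergence and stability of the shift-perturbed series. -/
theorem exists_shift_estimate (hM : IsIsotropicDilation M) (hd : 1 ≤ d) {s r α : ℝ}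
    (hs : (d : ℝ) / 2 < s) (hr : s < r) (hα : 0 < α) (hα' : α < min (2 * s - d) 2)
    {v : 𝓢'(Euc d, ℂ)} (hv : IsFt v (ft v)) {V : ℝ} (hV0 : 0 ≤ V)
    (hV : ∀ᵐ η, ‖ft v η‖ ≤ V) {u : L2 d} {B : ℝ} (hB : BracketLe (u : 𝓢'(Euc d, ℂ)) B) :
    ∃ C : ℝ, 0 < C ∧ ∀ (lam : Euc d) (ε : (Fin d → ℤ) → Euc d),
      Summable (fun k => ‖ε k - lam‖ ^ α) → ∀ (N : ℕ) (f : L2 d),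
        MemSobolev r 2 (f : 𝓢'(Euc d, ℂ)) →
        Summable (shiftTerm hM s u v N ε f) ∧
        ‖shiftOp hM s u v N 0 f - shiftOp hM s u v N ε f‖ ≤
          C * sobolevNorm r (f : 𝓢'(Euc d, ℂ)) * scale M ^ (-(N : ℝ) * zetaExp d s r α) *
            (‖lam‖ ^ zetaExp d s r α + maxNorm α (fun k => ε k - lam)) := by
  set ζ := zetaExp d s r α with hζ
  have hζ0 : 0 < ζ := zetaExp_pos hd hr hα hα'
  have hζ1 : ζ ≤ 1 := min_le_left _ _
  have hζ2 : ζ ≤ r - s := (min_le_right _ _).trans (min_le_left _ _)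
  have hα1 := lt_min_iff.1 hα'
  have hd' : (1 : ℝ) ≤ d := by exact_mod_cast hd
  have hs0 : 0 ≤ s := by linarith
  -- The smallest Hölder order serving both needs: `2β ≥ α` for summability and `β + d/2 ≥ ζ` for
  -- the decay rate. It stays at most `1` and below `r - d/2`, as the moment bound requires.
  set β := max (α / 2) (ζ - d / 2) with hβ
  have hβα : α / 2 ≤ β := le_max_left _ _
  have hβζ : ζ - d / 2 ≤ β := le_max_right _ _
  have hβ0 : 0 ≤ β := by linarith
  have hβ1 : β ≤ 1 := max_le (by linarith) (by linarith)
  have hβr : β < r - (d : ℝ) / 2 := max_lt (by linarith) (by linarith)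
  obtain ⟨K, hK, hKle⟩ := hM.exists_norm_symm_le hd
  obtain ⟨C₁, hC₁, hper⟩ := exists_periodize_bound hs
  obtain ⟨C₂, hC₂, hsamp⟩ := exists_sampleValue_sub_le hM hd hβ0 hβ1 hβr hv hV0 hV
  have hm := hM.scale_pos hd
  have hm1 := hM.one_lt_scale hd
  set D₁ : ℝ := Real.sqrt (C₁ * (V ^ 2 * (K ^ 2) ^ (s + ζ) * (4 * Real.pi) ^ 2)) with hD₁
  set D₂ : ℝ := C₂ * Real.sqrt 2 with hD₂
  -- The summand `1` keeps the constant positive even when `B = 0`.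
  refine ⟨Real.sqrt B * (D₁ + D₂) + 1, by positivity, fun lam ε hε N f hf => ?_⟩
  obtain ⟨S, hSE, -, hSn⟩ := exists_atomSynthesis hM hd s u hB N
  set F := sobolevNorm r (f : 𝓢'(Euc d, ℂ)) with hF
  have hF0 : 0 ≤ F := sobolevNorm_nonneg _ _
  set G := dilatedProduct hM (f : 𝓢'(Euc d, ℂ)) v N with hG
  set κ : ℝ := scale M ^ ((N : ℝ) * ((d : ℝ) / 2 + s)) with hκ
  have hκ0 : 0 < κ := Real.rpow_pos_of_pos hm _
  set x : (Fin d → ℤ) → Euc d := fun k => ε k - lam with hx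
  have hGi : Integrable G := integrable_dilatedProduct hM (hs.trans hr) hf hv hV N
  have hP := memLp_periodize_dilatedProduct hM hd hs hr.le hf hv hV N
  -- the contribution of the common shift
  have hw := dilatedProduct_weight hM hd hK hKle hs0 hζ0.le (by linarith) hf hv hV N
    (E := fun η => chr lam η - 1) ((continuous_chr lam).sub continuous_const)
    (c := 4 * Real.pi * ‖lam‖ ^ ζ) (norm_chr_sub_one_le hζ0.le hζ1 lam)
  obtain ⟨hP₁, hP₁n⟩ := hper _ hw.1
  have hi₁ := integrable_of_memLp_weight hs hw.1
  set H₀ : CubeL2 d := (κ : ℂ) • hP.toLp _ with hH₀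
  set H₁ : CubeL2 d := (κ : ℂ) • hP₁.toLp _ with hH₁
  have hlam : ∀ k : Fin d → ℤ, sampleValue hM (f : 𝓢'(Euc d, ℂ)) v N (lat k) +
      ∫ η, chr (lat k) η * ((chr lam η - 1) * G η) =
      sampleValue hM (f : 𝓢'(Euc d, ℂ)) v N (lat k + lam) := by
    intro k
    have hb : ∀ {g : Euc d → ℂ}, Integrable g → Integrable fun η => chr (lat k) η * g η :=
      fun hg => hg.bdd_mul (c := 1) (continuous_chr _).aestronglyMeasurable
        (Filter.Eventually.of_forall fun η => (norm_chr _ η).le)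
    rw [sampleValue, sampleValue, ← integral_add (hb hGi) (hb hi₁)]
    congr 1
    ext η
    rw [chr_add]
    ring
  have hnH₁ : ‖H₁‖ ≤ κ * (D₁ * (F * ‖lam‖ ^ ζ * (scale M ^ N)⁻¹ ^ ζ *
      Real.sqrt (scale M ^ (N * d))⁻¹)) := by
    rw [hH₁, norm_smul, Complex.norm_real, Real.norm_of_nonneg hκ0.le]
    refine mul_le_mul_of_nonneg_left ?_ hκ0.le
    refine le_of_sq_le_sq ((hP₁n.trans (mul_le_mul_of_nonneg_left hw.2 hC₁.le)).trans_eq ?_)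
      (by positivity)
    rw [mul_pow, mul_pow, mul_pow, mul_pow, Real.sq_sqrt (by positivity),
      Real.sq_sqrt (by positivity)]
    ring
  -- the contribution of the individual shifts
  set c₂ : (Fin d → ℤ) → ℂ := fun k => (κ : ℂ) *
    (sampleValue hM (f : 𝓢'(Euc d, ℂ)) v N (lat k + ε k) -
      sampleValue hM (f : 𝓢'(Euc d, ℂ)) v N (lat k + lam)) with hc₂
  set b : ℝ := κ * (C₂ * F * ((scale M ^ N)⁻¹ ^ β * (scale M ^ (N * d))⁻¹)) with hb
  have hb0 : 0 ≤ b := by positivity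
  have hc₂n : ∀ k, ‖c₂ k‖ ^ 2 ≤ b ^ 2 * ‖x k‖ ^ (2 * β) := by
    intro k
    have h1 := hsamp f hf N (lat k + lam) (x k)
    have h2 : lat k + lam + x k = lat k + ε k := by
      rw [hx, add_assoc, add_sub_cancel]
    rw [h2] at h1
    have h3 : ‖c₂ k‖ ≤ b * ‖x k‖ ^ β := by
      rw [hc₂, norm_mul, Complex.norm_real, Real.norm_of_nonneg hκ0.le, hb, mul_assoc]
      exact mul_le_mul_of_nonneg_left h1 hκ0.le
    refine (pow_le_pow_left₀ (norm_nonneg _) h3 2).trans_eq ?_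
    rw [mul_pow, ← Real.rpow_mul_natCast (norm_nonneg _)]
    congr 2
    push_cast
    ring
  have hxs : Summable fun k => ‖x k‖ ^ (2 * β) :=
    summable_norm_rpow_of_le hα (by linarith) hε
  have hc₂s : Summable fun k => ‖c₂ k‖ ^ 2 :=
    Summable.of_nonneg_of_le (fun k => by positivity) hc₂n (hxs.mul_left _)
  obtain ⟨H₂, hH₂, hH₂n⟩ := exists_cubeL2_of_summable hc₂s
  have hmax0 := maxNorm_nonneg α x
  have hnH₂ : ‖H₂‖ ≤ b * (Real.sqrt 2 * maxNorm α x) := by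
    refine le_of_sq_le_sq ?_ (by positivity)
    rw [hH₂n, mul_pow b, mul_pow (Real.sqrt 2), Real.sq_sqrt zero_le_two]
    refine (hc₂s.tsum_le_tsum hc₂n (hxs.mul_left _)).trans ?_
    rw [tsum_mul_left]
    exact mul_le_mul_of_nonneg_left (tsum_rpow_le_maxNorm hα (by linarith) (by linarith) hε)
      (by positivity)
  -- synthesis
  have hsum₀ : HasSum (shiftTerm hM s u v N 0 f) (S H₀) := by
    have h1 := ((hasSum_cubeExp (hP.toLp _)).const_smul (κ : ℂ)).mapL S
    refine h1.congr_fun fun k => ?_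
    rw [shiftTerm_eq hM s u hv, map_smul, map_smul, hSE, smul_smul,
      cubeBasis_repr_periodize hGi, sampleValue, Pi.zero_apply, add_zero]
  -- The sample at `k + ε_k` is the sample at `k`, plus the change from the common shift, plus the
  -- change from `x_k`. These are the coefficients of `H₀`, `H₁` and `H₂`.
  have hsum : HasSum (shiftTerm hM s u v N ε f) (S (H₀ + H₁ + H₂)) := by
    have h1 := ((((hasSum_cubeExp (hP.toLp _)).const_smul (κ : ℂ)).add
      ((hasSum_cubeExp (hP₁.toLp _)).const_smul (κ : ℂ))).add hH₂).mapL S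
    refine h1.congr_fun fun k => ?_
    rw [shiftTerm_eq hM s u hv, map_add, map_add, map_smul, map_smul, map_smul, map_smul, map_smul,
      hSE, smul_smul, smul_smul, ← add_smul, ← add_smul,
      cubeBasis_repr_periodize hGi, cubeBasis_repr_periodize hi₁]
    congr 1
    have h2 := hlam k
    have h3 : sampleValue hM (f : 𝓢'(Euc d, ℂ)) v N (lat k) = ∫ η, chr (lat k) η * G η := rfl
    rw [h3] at h2
    rw [hc₂]
    simp only
    rw [← h2]
    ring
  refine ⟨hsum.summable, ?_⟩
  have hsub : shiftOp hM s u v N 0 f - shiftOp hM s u v N ε f = -(S (H₁ + H₂)) := by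
    rw [shiftOp, shiftOp, hsum₀.tsum_eq, hsum.tsum_eq, map_add, map_add, map_add]
    abel
  rw [hsub, norm_neg]
  set z : ℝ := scale M ^ (-(N : ℝ) * ζ) with hz
  have hz0 : 0 < z := Real.rpow_pos_of_pos hm _
  have e₁ := scale_rpow_mul_eq hm N d s ζ
  have e₂ := scale_rpow_mul_le hm1 N (s := s) hβζ
  rw [← hκ, ← hz] at e₁ e₂
  set σ := scale M ^ (-(N : ℝ) * s) with hσ
  have hσ0 : 0 < σ := Real.rpow_pos_of_pos hm _
  have hlam0 : 0 ≤ ‖lam‖ ^ ζ := by positivity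
  have h5 : ‖S (H₁ + H₂)‖ ≤ σ * Real.sqrt B * (‖H₁‖ + ‖H₂‖) :=
    (hSn _).trans (by gcongr; exact norm_add_le _ _)
  have h6 : σ * ‖H₁‖ ≤ D₁ * (F * z * ‖lam‖ ^ ζ) := by
    refine (mul_le_mul_of_nonneg_left hnH₁ hσ0.le).trans_eq ?_
    rw [← e₁]; ring
  have h7 : σ * ‖H₂‖ ≤ D₂ * (F * z * maxNorm α x) := by
    refine (mul_le_mul_of_nonneg_left hnH₂ hσ0.le).trans ?_
    have h8 : 0 ≤ D₂ * F * maxNorm α x := by positivity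
    refine (le_of_eq ?_).trans ((mul_le_mul_of_nonneg_left e₂ h8).trans_eq (by ring))
    rw [hb, hD₂]; ring
  have h8 : 0 ≤ F * z * ‖lam‖ ^ ζ := by positivity
  have h9 : 0 ≤ F * z * maxNorm α x := by positivity
  have hD₁0 : 0 ≤ D₁ := Real.sqrt_nonneg _
  have hD₂0 : 0 ≤ D₂ := by positivity
  have hB0 := Real.sqrt_nonneg B
  calc ‖S (H₁ + H₂)‖ ≤ Real.sqrt B * (σ * ‖H₁‖ + σ * ‖H₂‖) := h5.trans_eq (by ring)
    _ ≤ Real.sqrt B * (D₁ * (F * z * ‖lam‖ ^ ζ) + D₂ * (F * z * maxNorm α x)) := by gcongr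
    _ ≤ Real.sqrt B * ((D₁ + D₂) * (F * z * ‖lam‖ ^ ζ) + (D₁ + D₂) * (F * z * maxNorm α x)) := by
      gcongr <;> linarith
    _ ≤ Real.sqrt B * ((D₁ + D₂) * (F * z * ‖lam‖ ^ ζ) + (D₁ + D₂) * (F * z * maxNorm α x)) +
        (F * z * ‖lam‖ ^ ζ + F * z * maxNorm α x) := by linarith
    _ = _ := by ring

/-! ### Wavelets obtained from refinable functions -/

theorem ae_two_pi_smul {p : Euc d → Prop} (h : ∀ᵐ ξ, p ξ) : ∀ᵐ η, p ((2 * Real.pi) • η) :=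
  (quasiMeasurePreserving_equiv (smulEquiv _ two_pi_ne_zero)).ae h

theorem bracketLe_of_bracket {u : L2 d} {B : ℝ} (h : ∀ᵐ ξ, bracket u ξ ≤ ENNReal.ofReal B) :
    BracketLe (u : 𝓢'(Euc d, ℂ)) (max B 0) := by
  refine ⟨le_max_right _ _, ?_⟩
  filter_upwards [ae_two_pi_smul h] with η hη
  refine le_trans (le_of_eq ?_) (hη.trans (ENNReal.ofReal_le_ofReal (le_max_left _ _)))
  refine tsum_congr fun k => ?_
  rw [ft, smul_add]

theorem exists_ft_bound {v : 𝓢'(Euc d, ℂ)} (h : MemLp (hat v) ⊤ volume) :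
    ∃ V : ℝ, 0 ≤ V ∧ ∀ᵐ η, ‖ft v η‖ ≤ V := by
  refine ⟨_, ENNReal.toReal_nonneg, ae_two_pi_smul (p := fun ξ => ‖hat v ξ‖ ≤
    (eLpNorm (hat v) ⊤ volume).toReal) ?_⟩
  filter_upwards [enorm_ae_le_eLpNormEssSup (hat v) volume] with ξ hξ
  rw [← eLpNorm_exponent_top] at hξ
  rw [← toReal_enorm]
  exact ENNReal.toReal_mono h.2.ne hξ

theorem exists_trigPoly_bound (c : (Fin d → ℤ) →₀ ℂ) :
    ∃ C : ℝ, 0 ≤ C ∧ ∀ ξ, ‖trigPoly c ξ‖ ≤ C := by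
  refine ⟨∑ k ∈ c.support, ‖c k‖, Finset.sum_nonneg fun _ _ => norm_nonneg _, fun ξ => ?_⟩
  refine (norm_sum_le _ _).trans (Finset.sum_le_sum fun k _ => ?_)
  rw [norm_mul, mul_comm Complex.I, Complex.norm_exp_ofReal_mul_I, mul_one]

theorem IsIsotropicDilation.det_ne_zero (hM : IsIsotropicDilation M) : M.det ≠ 0 := by
  have h := hM.isUnit_det.ne_zero
  have h2 : (realMat M).det = (M.det : ℝ) := ((Int.castRingHom ℝ).map_det M).symm
  rw [h2] at h
  exact_mod_cast h

theorem IsIsotropicDilation.transposeEquiv_lat (hM : IsIsotropicDilation M) (n : Fin d → ℤ) :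
    hM.transposeEquiv (lat n) = lat (M.transpose.mulVec n) := by
  rw [hM.transposeEquiv_apply]
  ext i
  simp [act, lat, Matrix.mulVec, dotProduct, realMat]

theorem IsIsotropicDilation.mulVec_injective (hM : IsIsotropicDilation M) :
    Function.Injective (fun n : Fin d → ℤ => M.transpose.mulVec n) := by
  intro n m h
  have h1 : lat n = lat m := hM.transposeEquiv.injective (by
    rw [hM.transposeEquiv_lat, hM.transposeEquiv_lat]; exact congrArg lat h)
  ext i
  have := congrArg (fun x : Euc d => x i) h1
  simpa using this

/-- Integer vectors decompose as a remainder from a finite set plus an element of `Mᵀℤᵈ`. -/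
theorem exists_remainder (hM : IsIsotropicDilation M) (k : Fin d → ℤ) :
    ∃ r ∈ Fintype.piFinset (fun _ : Fin d => Finset.Ico 0 |M.det|), ∃ n : Fin d → ℤ,
      k = r + M.transpose.mulVec n := by
  -- Since `Mᵀ · adj(Mᵀ) = det M · I`, every vector in `det M · ℤᵈ` lies in `Mᵀℤᵈ`, so
  -- coordinatewise remainders modulo the determinant suffice. They need not represent distinct
  -- cosets.
  refine ⟨fun i => k i % M.det, ?_, M.transpose.adjugate.mulVec (fun i => k i / M.det), ?_⟩
  · rw [Fintype.mem_piFinset]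
    intro i
    rw [Finset.mem_Ico]
    exact ⟨Int.emod_nonneg _ hM.det_ne_zero, Int.emod_lt_abs _ hM.det_ne_zero⟩
  · rw [Matrix.mulVec_mulVec, Matrix.mul_adjugate, Matrix.det_transpose, Matrix.smul_mulVec,
      Matrix.one_mulVec]
    ext i
    simp [Int.emod_add_mul_ediv]

/-- The bracket of a wavelet is bounded. -/
theorem bracketLe_wavelet (hM : IsIsotropicDilation M) {u w : 𝓢'(Euc d, ℂ)} {B : ℝ}
    (hB : BracketLe u B) {C : ℝ} (hC0 : 0 ≤ C)
    (hw : ∀ᵐ η, ‖ft w (hM.transposeEquiv η)‖ ≤ C * ‖ft u η‖) : ∃ B', BracketLe w B' := by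
  set A := hM.transposeEquiv with hA
  set R := Fintype.piFinset (fun _ : Fin d => Finset.Ico 0 |M.det|) with hR
  refine ⟨C ^ 2 * (R.card * B), by have := hB.1; positivity, ?_⟩
  have h1 : ∀ᵐ ξ, ‖ft w ξ‖ ≤ C * ‖ft u (A.symm ξ)‖ := by
    filter_upwards [(quasiMeasurePreserving_equiv A.symm).ae hw] with ξ hξ
    rwa [A.apply_symm_apply] at hξ
  have h2 : ∀ᵐ ξ, ∀ r : Fin d → ℤ,
      ∑' n : Fin d → ℤ, ‖ft u (A.symm (ξ + lat r) + lat n)‖ₑ ^ 2 ≤ ENNReal.ofReal B :=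
    ae_forall_add_lat ((quasiMeasurePreserving_equiv A.symm).ae hB.2)
  filter_upwards [ae_forall_add_lat h1, h2] with ξ h1 h2
  choose r hr n hn using exists_remainder hM
  -- Grouping by remainder turns the points `(Mᵀ)⁻¹(ξ + k)` into integer translates of finitely many
  -- base points. Injectivity allows the sum to be enlarged to all pairs, each remainder
  -- contributing at most `B`.
  have hinj : Function.Injective fun k => ((⟨r k, hr k⟩ : R), n k) := by
    intro k l hkl
    simp only [Prod.mk.injEq, Subtype.mk.injEq] at hkl
    rw [hn k, hn l, hkl.1, hkl.2]
  set g : R × (Fin d → ℤ) → ℝ≥0∞ := fun p =>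
    ‖ft u (A.symm (ξ + lat p.1.1) + lat p.2)‖ₑ ^ 2 with hg
  have hterm : ∀ k : Fin d → ℤ, ‖ft w (ξ + lat k)‖ₑ ^ 2 ≤
      ENNReal.ofReal (C ^ 2) * g (⟨r k, hr k⟩, n k) := by
    intro k
    have h3 : A.symm (ξ + lat k) = A.symm (ξ + lat (r k)) + lat (n k) := by
      apply A.injective
      rw [A.apply_symm_apply, A.map_add (A.symm _) (lat _), A.apply_symm_apply, hA,
        hM.transposeEquiv_lat, add_assoc, ← lat_add, ← hn k]
    rw [hg]
    simp only
    rw [← h3, ENNReal.ofReal_pow hC0, ← mul_pow]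
    gcongr
    rw [← ofReal_norm, ← ofReal_norm, ← ENNReal.ofReal_mul hC0]
    exact ENNReal.ofReal_le_ofReal (h1 k)
  calc ∑' k : Fin d → ℤ, ‖ft w (ξ + lat k)‖ₑ ^ 2
      ≤ ∑' k : Fin d → ℤ, ENNReal.ofReal (C ^ 2) * g (⟨r k, hr k⟩, n k) :=
        ENNReal.tsum_le_tsum hterm
    _ = ENNReal.ofReal (C ^ 2) * ∑' k : Fin d → ℤ, g (⟨r k, hr k⟩, n k) := ENNReal.tsum_mul_left
    _ ≤ ENNReal.ofReal (C ^ 2) * ∑' p, g p := by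
        gcongr
        exact ENNReal.tsum_comp_le_tsum_of_injective hinj g
    _ ≤ ENNReal.ofReal (C ^ 2) * (R.card * ENNReal.ofReal B) := by
        gcongr
        rw [ENNReal.tsum_prod', tsum_fintype]
        refine (Finset.sum_le_sum fun p _ => h2 p.1).trans_eq ?_
        rw [Finset.sum_const, Finset.card_univ, Fintype.card_coe, nsmul_eq_mul]
    _ = _ := by
        rw [ENNReal.ofReal_mul (sq_nonneg C), ENNReal.ofReal_mul (Nat.cast_nonneg _),
          ENNReal.ofReal_natCast]

/-! ### The cascade identity -/

theorem ae_add_right' {p : Euc d → Prop} (h : ∀ᵐ x, p x) (A : Euc d ≃L[ℝ] Euc d) :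
    ∀ᵐ x, ∀ n : Fin d → ℤ, p (x + A (lat n)) := ae_all_iff.2 fun _ => ae_add_right h _

/-- Expresses a level-`j` term at `Mᵀη + n` through the refined point `η + (Mᵀ)⁻¹n`, where the
refinement equations apply. -/
theorem periodize_dilatedProduct_apply (hM : IsIsotropicDilation M) (f w : 𝓢'(Euc d, ℂ)) (j : ℕ)
    (η : Euc d) (n : Fin d → ℤ) :
    dilatedProduct hM f w j (hM.transposeEquiv η + lat n) =
      ft f ((hM.transposeEquiv ^ (j + 1)) (η + hM.transposeEquiv.symm (lat n))) *
        (starRingEnd ℂ) (ft w (hM.transposeEquiv (η + hM.transposeEquiv.symm (lat n)))) := by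
  have h : hM.transposeEquiv (η + hM.transposeEquiv.symm (lat n)) =
      hM.transposeEquiv η + lat n := by
    rw [map_add, ContinuousLinearEquiv.apply_symm_apply]
  rw [dilatedProduct, pow_succ]
  change _ = ft f ((hM.transposeEquiv ^ j) (hM.transposeEquiv _)) * _
  rw [h]

/-- After the refinement equations, every term on the right contains the same `T n`, and its mask
factors sum over all generators to the indicator of `Mᵀℤᵈ`. On that sublattice `(Mᵀ)⁻¹n` runs
through ℤᵈ, which reproduces the level `j+1` periodization. -/
theorem cascade_ae (hM : IsIsotropicDilation M) {s r : ℝ} (hr : (d : ℝ) / 2 < r) {φ : L2 d}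
    {φt : 𝓢'(Euc d, ℂ)} {L : ℕ} {ψ : Fin L → L2 d} {ψt : Fin L → 𝓢'(Euc d, ℂ)}
    {a at' : Euc d → ℂ} {b bt : Fin L → ((Fin d → ℤ) →₀ ℂ)}
    (h : IsMEPSystem M s φ φt ψ ψt a at' b bt) {f : 𝓢'(Euc d, ℂ)} (hf : MemSobolev r 2 f)
    (hv : IsFt φt (ft φt)) {V : ℝ} (hV : ∀ᵐ η, ‖ft φt η‖ ≤ V)
    (hv' : ∀ l, IsFt (ψt l) (ft (ψt l))) {V' : Fin L → ℝ} (hV' : ∀ l, ∀ᵐ η, ‖ft (ψt l) η‖ ≤ V' l)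
    (j : ℕ) : ∀ᵐ η, ft (φ : 𝓢'(Euc d, ℂ)) η * periodize (dilatedProduct hM f φt (j + 1)) η =
      ft (φ : 𝓢'(Euc d, ℂ)) (hM.transposeEquiv η) *
          periodize (dilatedProduct hM f φt j) (hM.transposeEquiv η) +
        ∑ l, ft (ψ l : 𝓢'(Euc d, ℂ)) (hM.transposeEquiv η) *
          periodize (dilatedProduct hM f (ψt l) j) (hM.transposeEquiv η) := by
  set A := hM.transposeEquiv with hA
  have q := quasiMeasurePreserving_equiv A
  have hsφ := q.ae (ae_summable_add_lat (integrable_dilatedProduct hM hr hf hv hV j))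
  have hsψ := ae_all_iff.2 fun l => q.ae (ae_summable_add_lat
    (integrable_dilatedProduct hM hr hf (hv' l) (hV' l) j))
  have hAη : ∀ η, act (realMat M).transpose ((2 * Real.pi) • η) = (2 * Real.pi) • A η := fun η =>
    A.map_smul (2 * Real.pi) η
  have hmask : ∀ᵐ η, ft (φ : 𝓢'(Euc d, ℂ)) (A η) =
      a ((2 * Real.pi) • η) * ft (φ : 𝓢'(Euc d, ℂ)) η := by
    filter_upwards [ae_two_pi_smul h.mask.refine_eq] with η hη
    rwa [hAη] at hη
  have hmask' : ∀ᵐ η, ft φt (A η) = at' ((2 * Real.pi) • η) * ft φt η := by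
    filter_upwards [ae_two_pi_smul h.dual_mask.refine_eq] with η hη
    rwa [hAη] at hη
  have hwav : ∀ᵐ η, ∀ l, ft (ψ l : 𝓢'(Euc d, ℂ)) (A η) =
      trigPoly (b l) ((2 * Real.pi) • η) * ft (φ : 𝓢'(Euc d, ℂ)) η := by
    filter_upwards [ae_two_pi_smul (ae_all_iff.2 h.wavelet)] with η hη l
    have := hη l
    rwa [hAη] at this
  have hwav' : ∀ᵐ η, ∀ l, ft (ψt l) (A η) =
      trigPoly (bt l) ((2 * Real.pi) • η) * ft φt η := by
    filter_upwards [ae_two_pi_smul (ae_all_iff.2 h.dual_wavelet)] with η hη l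
    have := hη l
    rwa [hAη] at this
  filter_upwards [hsφ, hsψ, hmask, hwav, ae_add_right' hmask' A.symm, ae_add_right' hwav' A.symm,
    ae_add_right' (ae_two_pi_smul h.mep) A.symm] with η hsφ hsψ hmask hwav hmask' hwav' hmep
  set I : (Fin d → ℤ) → ℂ := Set.indicator (Set.range fun n : Fin d → ℤ => M.transpose.mulVec n)
    (fun _ => (1 : ℂ)) with hI
  set T : (Fin d → ℤ) → ℂ := fun n => ft f ((A ^ (j + 1)) (η + A.symm (lat n))) *
    (starRingEnd ℂ) (ft φt (η + A.symm (lat n))) with hT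
  have hTφ : ∀ n, dilatedProduct hM f φt j (A η + lat n) =
      T n * (starRingEnd ℂ) (at' ((2 * Real.pi) • (η + A.symm (lat n)))) := fun n => by
    rw [hA, periodize_dilatedProduct_apply, ← hA, hmask' n, map_mul, hT]
    ring
  have hTψ : ∀ l n, dilatedProduct hM f (ψt l) j (A η + lat n) =
      T n * (starRingEnd ℂ) (trigPoly (bt l) ((2 * Real.pi) • (η + A.symm (lat n)))) :=
      fun l n => by
    rw [hA, periodize_dilatedProduct_apply, ← hA, hwav' n l, map_mul, hT]
    ring
  have hmep' : ∀ n, a ((2 * Real.pi) • η) *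
      (starRingEnd ℂ) (at' ((2 * Real.pi) • (η + A.symm (lat n)))) +
      ∑ l, trigPoly (b l) ((2 * Real.pi) • η) *
        (starRingEnd ℂ) (trigPoly (bt l) ((2 * Real.pi) • (η + A.symm (lat n)))) = I (-n) := by
    intro n
    -- The extension principle is used at the translated point `η + (Mᵀ)⁻¹n` with shift `-n`. This
    -- returns the primal masks to `η`; conjugation then puts the bar on the dual masks.
    have h1 := hmep n (-n)
    have h2 : (2 * Real.pi) • (η + A.symm (lat n)) +
        (2 * Real.pi) • act (realMat M).transpose⁻¹ (lat (-n)) = (2 * Real.pi) • η := by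
      rw [← hM.transposeEquiv_symm_apply, ← hA, lat_neg, map_neg, ← smul_add,
        add_neg_cancel_right]
    rw [h2] at h1
    have h3 := congrArg (starRingEnd ℂ) h1
    have h4 : (starRingEnd ℂ) (I (-n)) = I (-n) := by
      classical
      rw [hI, Set.indicator_apply]
      split_ifs <;> simp
    rw [h4] at h3
    rw [← h3]
    simp only [map_add, map_sum, map_mul, Complex.conj_conj]
    ring
  have hleft : periodize (dilatedProduct hM f φt (j + 1)) η = ∑' n, T n * I (-n) := by
    -- The indicator restricts the sum to the range of `n ↦ Mᵀn`, which injectivity reparametrises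
    -- by ℤᵈ.
    rw [periodize, ← hM.mulVec_injective.tsum_eq (f := fun n => T n * I (-n))]
    · refine tsum_congr fun n => ?_
      have h1 : A.symm (lat (M.transpose.mulVec n)) = lat n := by
        rw [← hM.transposeEquiv_lat, ← hA, A.symm_apply_apply]
      have h2 : I (-M.transpose.mulVec n) = 1 := by
        rw [hI, Set.indicator_of_mem]
        exact ⟨-n, Matrix.mulVec_neg _ _⟩
      rw [h2, mul_one, hT]
      simp only
      rw [h1]
      rfl
    · intro n hn
      have h1 : I (-n) ≠ 0 := right_ne_zero_of_mul hn
      obtain ⟨m, hm⟩ := Set.mem_of_indicator_ne_zero h1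
      refine ⟨-m, ?_⟩
      simp only at hm ⊢
      rw [Matrix.mulVec_neg, hm, neg_neg]
  have hφ : ft (φ : 𝓢'(Euc d, ℂ)) (A η) * periodize (dilatedProduct hM f φt j) (A η) =
      ft (φ : 𝓢'(Euc d, ℂ)) η * ∑' n, T n * (a ((2 * Real.pi) • η) *
        (starRingEnd ℂ) (at' ((2 * Real.pi) • (η + A.symm (lat n))))) := by
    rw [hmask, periodize, ← tsum_mul_left, ← tsum_mul_left]
    refine tsum_congr fun n => ?_
    rw [hTφ]; ring
  have hψ : ∀ l, ft (ψ l : 𝓢'(Euc d, ℂ)) (A η) * periodize (dilatedProduct hM f (ψt l) j) (A η) =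
      ft (φ : 𝓢'(Euc d, ℂ)) η * ∑' n, T n * (trigPoly (b l) ((2 * Real.pi) • η) *
        (starRingEnd ℂ) (trigPoly (bt l) ((2 * Real.pi) • (η + A.symm (lat n))))) := by
    intro l
    rw [hwav, periodize, ← tsum_mul_left, ← tsum_mul_left]
    refine tsum_congr fun n => ?_
    rw [hTψ]; ring
  have hsφ' : Summable fun n => T n * (a ((2 * Real.pi) • η) *
        (starRingEnd ℂ) (at' ((2 * Real.pi) • (η + A.symm (lat n))))) := by
    refine (hsφ.of_norm.mul_left (a ((2 * Real.pi) • η))).congr fun n => ?_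
    rw [hTφ]; ring
  have hsψ' : ∀ l, Summable fun n => T n * (trigPoly (b l) ((2 * Real.pi) • η) *
        (starRingEnd ℂ) (trigPoly (bt l) ((2 * Real.pi) • (η + A.symm (lat n))))) := by
    intro l
    refine ((hsψ l).of_norm.mul_left (trigPoly (b l) ((2 * Real.pi) • η))).congr fun n => ?_
    rw [hTψ]; ring
  rw [hφ, hleft]
  simp_rw [hψ]
  rw [← Finset.mul_sum, ← mul_add, ← Summable.tsum_finsetSum (fun l _ => hsψ' l),
    ← hsφ'.tsum_add (summable_sum fun l _ => hsψ' l)]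
  congr 1
  refine tsum_congr fun n => ?_
  rw [← hmep' n, mul_add, Finset.mul_sum]

/-- A trigonometric polynomial is bounded, and the a.e. bound along `Mᵀη` transfers to `η` because
`Mᵀ` is invertible and preserves null sets. -/
theorem IsMEPSystem.exists_dual_bound (hM : IsIsotropicDilation M) {s : ℝ} {φ : L2 d}
    {φt : 𝓢'(Euc d, ℂ)} {L : ℕ} {ψ : Fin L → L2 d} {ψt : Fin L → 𝓢'(Euc d, ℂ)}
    {a at' : Euc d → ℂ} {b bt : Fin L → ((Fin d → ℤ) →₀ ℂ)}
    (h : IsMEPSystem M s φ φt ψ ψt a at' b bt) {V : ℝ}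
    (hV : ∀ᵐ η, ‖ft φt η‖ ≤ V) (l : Fin L) : ∃ V', ∀ᵐ η, ‖ft (ψt l) η‖ ≤ V' := by
  obtain ⟨C, hC0, hC⟩ := exists_trigPoly_bound (bt l)
  refine ⟨C * V, ?_⟩
  have h1 : ∀ᵐ η, ‖ft (ψt l) (hM.transposeEquiv η)‖ ≤ C * V := by
    filter_upwards [ae_two_pi_smul (h.dual_wavelet l), hV] with η hη hVη
    have h2 : act (realMat M).transpose ((2 * Real.pi) • η) =
      (2 * Real.pi) • hM.transposeEquiv η := hM.transposeEquiv.map_smul (2 * Real.pi) η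
    rw [h2] at hη
    change ‖hat (ψt l) _‖ ≤ _
    rw [hη, norm_mul]
    exact mul_le_mul (hC _) hVη (norm_nonneg _) hC0
  filter_upwards [(quasiMeasurePreserving_equiv hM.transposeEquiv.symm).ae h1] with η hη
  rwa [ContinuousLinearEquiv.apply_symm_apply] at hη

theorem IsMEPSystem.exists_bracketLe (hM : IsIsotropicDilation M) {s : ℝ} {φ : L2 d}
    {φt : 𝓢'(Euc d, ℂ)} {L : ℕ} {ψ : Fin L → L2 d} {ψt : Fin L → 𝓢'(Euc d, ℂ)}
    {a at' : Euc d → ℂ} {b bt : Fin L → ((Fin d → ℤ) →₀ ℂ)}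
    (h : IsMEPSystem M s φ φt ψ ψt a at' b bt) {B : ℝ}
    (hB : BracketLe (φ : 𝓢'(Euc d, ℂ)) B) (l : Fin L) :
    ∃ B', BracketLe (ψ l : 𝓢'(Euc d, ℂ)) B' := by
  obtain ⟨C, hC0, hC⟩ := exists_trigPoly_bound (b l)
  refine bracketLe_wavelet hM hB hC0 ?_
  filter_upwards [ae_two_pi_smul (h.wavelet l)] with η hη
  have h2 : act (realMat M).transpose ((2 * Real.pi) • η) =
    (2 * Real.pi) • hM.transposeEquiv η := hM.transposeEquiv.map_smul (2 * Real.pi) η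
  rw [h2] at hη
  change ‖hat (ψ l : 𝓢'(Euc d, ℂ)) _‖ ≤ _
  rw [hη, norm_mul]
  exact mul_le_mul_of_nonneg_right (hC _) (norm_nonneg _)

/-- One step of the cascade: `S^{j+1}_φ f = S^j_φ f + ∑_ℓ S^j_{ψ^ℓ} f`. -/
theorem IsMEPSystem.shiftOp_succ (hM : IsIsotropicDilation M) (hd : 1 ≤ d) {s r : ℝ}
    (hs : (d : ℝ) / 2 < s) (hr : s ≤ r) {φ : L2 d}
    {φt : 𝓢'(Euc d, ℂ)} {L : ℕ} {ψ : Fin L → L2 d} {ψt : Fin L → 𝓢'(Euc d, ℂ)}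
    {a at' : Euc d → ℂ} {b bt : Fin L → ((Fin d → ℤ) →₀ ℂ)}
    (h : IsMEPSystem M s φ φt ψ ψt a at' b bt) {f : L2 d}
    (hf : MemSobolev r 2 (f : 𝓢'(Euc d, ℂ))) (hv : IsFt φt (ft φt)) {V : ℝ}
    (hV : ∀ᵐ η, ‖ft φt η‖ ≤ V) {B : ℝ} (hB : BracketLe (φ : 𝓢'(Euc d, ℂ)) B) :
    (∀ l, ∀ j : ℕ, Summable (shiftTerm hM s (ψ l) (ψt l) j 0 f)) ∧
    ∀ j : ℕ, shiftOp hM s φ φt (j + 1) 0 f =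
      shiftOp hM s φ φt j 0 f + ∑ l, shiftOp hM s (ψ l) (ψt l) j 0 f := by
  have hv' : ∀ l, IsFt (ψt l) (ft (ψt l)) := fun l =>
    (exists_isFt_of_memSobolev (h.dual_mem l)).1
  choose V' hV' using h.exists_dual_bound hM hV
  choose B' hB' using h.exists_bracketLe hM hB
  have hψ := fun l => shiftOp_zero hM hd hs hr hf (hv' l) (hV' l) (hB' l)
  have hφ := shiftOp_zero hM hd hs hr hf hv hV hB
  refine ⟨fun l j => (hψ l j).1, fun j => ?_⟩
  apply (Lp.fourierTransformₗᵢ (Euc d) ℂ).injective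
  rw [map_add, map_sum]
  change (𝓕 (shiftOp hM s φ φt (j + 1) 0 f) : L2 d) =
    𝓕 (shiftOp hM s φ φt j 0 f) + ∑ l, 𝓕 (shiftOp hM s (ψ l) (ψt l) j 0 f)
  -- The cascade identity is read at `(Mᵀ)^{-(j+1)}ξ`, so that `Mᵀ` takes this point to the argument
  -- `(Mᵀ)^{-j}ξ` of the level-`j` transforms.
  have hcas := (quasiMeasurePreserving_equiv (hM.transposeEquiv ^ (j + 1)).symm).ae
    (cascade_ae hM (hs.trans_le hr) h hf hv hV hv' hV' j)
  refine Lp.ext ?_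
  filter_upwards [Lp.coeFn_add (𝓕 (shiftOp hM s φ φt j 0 f))
      (∑ l, 𝓕 (shiftOp hM s (ψ l) (ψt l) j 0 f)),
    Lp.coeFn_fun_finsetSum Finset.univ fun l => 𝓕 (shiftOp hM s (ψ l) (ψt l) j 0 f),
    (hφ (j + 1)).2, (hφ j).2, ae_all_iff.2 fun l => (hψ l j).2, hcas] with ξ h1 h2 h3 h4 h5 h6
  have h7 : hM.transposeEquiv ((hM.transposeEquiv ^ (j + 1)).symm ξ) =
      (hM.transposeEquiv ^ j).symm ξ := by
    rw [pow_succ]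
    exact hM.transposeEquiv.apply_symm_apply _
  rw [h7] at h6
  rw [h1, Pi.add_apply, h2, h3, h4, h6]
  congr 1
  exact Finset.sum_congr rfl fun l _ => (h5 l).symm

/-- Telescoping of the one-step identity over the levels below `N`. -/
theorem IsMEPSystem.frameletOp_eq (hM : IsIsotropicDilation M) (hd : 1 ≤ d) {s r : ℝ}
    (hs : (d : ℝ) / 2 < s) (hr : s ≤ r) {φ : L2 d}
    {φt : 𝓢'(Euc d, ℂ)} {L : ℕ} {ψ : Fin L → L2 d} {ψt : Fin L → 𝓢'(Euc d, ℂ)}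
    {a at' : Euc d → ℂ} {b bt : Fin L → ((Fin d → ℤ) →₀ ℂ)}
    (h : IsMEPSystem M s φ φt ψ ψt a at' b bt) {f : L2 d}
    (hf : MemSobolev r 2 (f : 𝓢'(Euc d, ℂ))) (hv : IsFt φt (ft φt)) {V : ℝ}
    (hV : ∀ᵐ η, ‖ft φt η‖ ≤ V) {B : ℝ} (hB : BracketLe (φ : 𝓢'(Euc d, ℂ)) B) (N : ℕ) :
    frameletOp hM s φ φt ψ ψt N f = shiftOp hM s φ φt N 0 f := by
  induction N with
  | zero => simp [frameletOp]
  | succ N ih =>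
    rw [(h.shiftOp_succ hM hd hs hr hf hv hV hB).2 N, ← ih]
    simp only [frameletOp, Finset.sum_range_succ, Finset.sum_add_distrib, add_assoc]

end FrameletShift

end

/-! ### The theorem -/

open FrameletShift in
theorem theorem3p1 (d : ℕ) (hd : 1 ≤ d) (M : Matrix (Fin d) (Fin d) ℤ)
    (hM : IsIsotropicDilation M) (s ς α : ℝ) (hs : (d : ℝ) / 2 < s) (hsς : s < ς)
    (hα : 0 < α) (hα' : α < min (2 * s - d) 2)
    (φ : L2 d) (hφ : MemSobolev ς 2 (φ : 𝓢'(Euc d, ℂ)))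
    (hφr : IsRefinable M (φ : 𝓢'(Euc d, ℂ)))
    (hφb : ∃ B : ℝ, ∀ᵐ ξ, bracket φ ξ ≤ ENNReal.ofReal B)
    (φt : 𝓢'(Euc d, ℂ)) (hφt : MemSobolev (-s) 2 φt) (hφtr : IsRefinable M φt)
    (hφtb : MemLp (hat φt) ⊤ volume) :
    ∃ C : ℝ, 0 < C ∧
      ∀ (lam : Euc d) (ε : (Fin d → ℤ) → Euc d), Summable (fun k => ‖ε k - lam‖ ^ α) →
      ∀ N : ℕ, (2 * s + 2 - α) / (2 - α) * Real.logb (scale M) d ≤ N →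
      ∀ f : L2 d, MemSobolev ς 2 (f : 𝓢'(Euc d, ℂ)) →
        Summable (shiftTerm hM s φ φt N 0 f) ∧
        Summable (shiftTerm hM s φ φt N ε f) ∧
        ‖f - shiftOp hM s φ φt N ε f‖ ≤ ‖f - shiftOp hM s φ φt N 0 f‖ +
          C * sobolevNorm ς (f : 𝓢'(Euc d, ℂ)) * scale M ^ (-(N : ℝ) * zetaExp d s ς α) *
            (‖lam‖ ^ zetaExp d s ς α + maxNorm α (fun k => ε k - lam)) ∧
        ∀ (L : ℕ) (ψ : Fin L → L2 d) (ψt : Fin L → 𝓢'(Euc d, ℂ)) (a at' : Euc d → ℂ)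
          (b bt : Fin L → ((Fin d → ℤ) →₀ ℂ)), IsMEPSystem M s φ φt ψ ψt a at' b bt →
          (∀ l, ∀ j : ℕ, Summable (shiftTerm hM s (ψ l) (ψt l) j 0 f)) ∧
          frameletOp hM s φ φt ψ ψt N f = shiftOp hM s φ φt N 0 f := by
  obtain ⟨B, hB⟩ := hφb
  replace hB := bracketLe_of_bracket hB
  obtain ⟨V, hV0, hV⟩ := exists_ft_bound hφtb
  have hv := (exists_isFt_of_memSobolev hφt).1
  obtain ⟨C, hC, H⟩ := exists_shift_estimate hM hd hs hsς hα hα' hv hV0 hV hB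
  refine ⟨C, hC, fun lam ε hε N _ f hf => ?_⟩
  obtain ⟨hsum, hle⟩ := H lam ε hε N f hf
  refine ⟨(shiftOp_zero hM hd hs hsς.le hf hv hV hB N).1, hsum, ?_, fun L ψ ψt a at' b bt h =>
    ⟨(h.shiftOp_succ hM hd hs hsς.le hf hv hV hB).1,
      h.frameletOp_eq hM hd hs hsς.le hf hv hV hB N⟩⟩
  -- The triangle inequality through the unperturbed operator reduces the claim to the stability
  -- estimate.
  exact (norm_sub_le_norm_sub_add_norm_sub f (shiftOp hM s φ φt N 0 f)
    (shiftOp hM s φ φt N ε f)).trans (by gcongr)
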